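/- **Setting.** Let $n\ge 0$. Let $\mathrm{Spin}(n)$ be the compact spin group inside the Clifford algebra of Euclidean $\mathbb R^n$ ($x\cdot x=|x|^2$), let $\mathcal S_n$ be the commutative $*$-algebra of complex polynomial functions on it (the functions generated by the linear functionals of the Clifford algebra), with coproduct $\phi(a)(g,h)=a(gh)$ and counit $\epsilon(a)=a(1)$, and let $u_{ji}\in\mathcal S_n$ be given by $g e_i g^{-1}=\sum_j u_{ji}(g)e_j$. Let $V,B$ be unital complex $*$-algebras and $P=(B,i,F)$ a quantum principal $\mathrm{Spin}(n)$-bundle: $i:V\to B$ is an injective $*$-homomorphism, $F:B\to B\otimes\mathcal S_n$ is a $*$-homomorphism with $(\mathrm{id}\otimes\phi)F=(F\otimes\mathrm{id})F$ and $(\mathrm{id}\otimes\epsilon)F=\mathrm{id}$, $i(V)=\{b: F(b)=b\otimes 1\}$, and for each $a\in\mathcal S_n$ there are $q_k,b_k\in B$ with $\sum_k (q_k\otimes1) F(b_k)=1\otimes a$. Let $(\partial_1,\dots,\partial_n)$ be a frame structure: hermitian derivations $\partial_i:V\to B$ with $F\partial_i(f)=\sum_j\partial_j(f)\otimes u_{ji}$,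 such that there are $b_{i\alpha}\in B$, $v_{i\alpha}\in V$ with $\sum_\alpha b_{i\alpha}\partial_j(v_{i\alpha})=\delta_{ij}1$. Assume it is integrable through hermitian derivations $X_1,\dots,X_n$ of $B$ extending the $\partial_i$, with $X_i\partial_j=X_j\partial_i$ and $FX_i(b)=\sum_{j,k}X_j(b_k)\otimes u_{ji}c_k$ for $F(b)=\sum_k b_k\otimes c_k$. On horizontal forms $\mathrm{hor}_P=B\otimes\Lambda\mathbb C^n$ put $\nabla(b\otimes\vartheta)=\sum_k X_k(b)\otimes(e_k\wedge\vartheta)$ and $F^\star(b\otimes\vartheta)=F(b)u^\wedge(\vartheta)$, where $u^\wedge:\Lambda\mathbb C^n\to\Lambda\mathbb C^n\otimes\mathcal S_n$ is the algebra homomorphism with $u^\wedge(e_i)=\sum_j e_j\otimes u_{ji}$. Let $\star$ be the Hodge operator, with $e_I\wedge\star e_I=e_1\wedge\dots\wedge e_n$, acting on the second factor of $\mathrm{hor}_P$, and $\nabla^\dagger=-(-1)^{n-nk}\star\nabla\star$ on $k$-forms. Let $r=\lfloor n/2\rfloor$ and let $\mathbb S=\Lambda V_+$ be the spinor space, where $V_\pm$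 is the span of the $(e_{2j-1}\pm i e_{2j})/\sqrt2$, $1\le j\le r$. It has the basis $\sigma_I=\prod_{j\in I}(e_{2j-1}+i e_{2j})/\sqrt2$, $I\subseteq\{1,\dots,r\}$ (increasing products), and the Clifford action $x\xi=x_+\wedge\xi+x_-\lrcorner\,\xi$ for $x=(x_++x_-)/\sqrt2$, $x_\pm\in V_\pm$; if $n$ is odd, $e_n$ acts as the parity operator of $\Lambda V_+$. Let $\gamma_i$ be the action of $e_i$, let $U$ be the restriction of the action to $\mathrm{Spin}(n)$, and let $U_{JI}\in\mathcal S_n$ be its matrix elements, $U(g)\sigma_I=\sum_J U_{JI}(g)\sigma_J$. The space $\mathcal E$ of sections of the associated spinor bundle consists of the elements $\psi=\sum_I\psi_I\otimes\sigma_I\in B\otimes\mathbb S$ that are invariant under the product of the actions $F$ and $U$. Put $$D_E(\psi)=-i\sum_{i,I}X_i(\psi_I)\otimes\gamma_i\sigma_I,\qquad \Delta_E=\nabla_E\nabla_E^\dagger+\nabla_E^\dagger\nabla_E,\quad \nabla_E=\nabla\otimes\mathrm{id},\ \nabla_E^\dagger=\nabla^\dagger\otimes\mathrm{id}\ \text{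 on } \mathrm{hor}_P\otimes\mathbb S ,$$ where $B\otimes\mathbb S$ is regarded as the degree-zero part of $\mathrm{hor}_P\otimes\mathbb S$. **Claim.** There is a unique linear map $\varrho:\mathcal S_n\to\mathrm{hor}_P$ (the curvature) such that $\nabla^2(\varphi)=-\sum_k\varphi_k\varrho(c_k)$ for all $\varphi\in\mathrm{hor}_P$, where $F^\star(\varphi)=\sum_k\varphi_k\otimes c_k$. It has the form $\varrho(a)=\frac12\sum_{ij}\varrho_{ij}(a)\otimes(e_i\wedge e_j)$ with linear maps $\varrho_{ij}=-\varrho_{ji}:\mathcal S_n\to B$. Let $$\varrho_E(\psi)=-\tfrac12\sum_{ijIJ}\psi_I\,\varrho_{ij}(U_{JI})\otimes\gamma_i\gamma_j\sigma_J .$$ If the curvature is classical, that is, $\varrho(ab)=\epsilon(a)\varrho(b)+\epsilon(b)\varrho(a)$ for all $a,b\in\mathcal S_n$, then $D_E$ and $\varrho_E$ map $\mathcal E$ into $\mathcal E$, and on $\mathcal E$ $$D_E^2=\Delta_E+\varrho_E .$$ -/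

import Mathlib

open scoped TensorProduct

noncomputable section

namespace QSpin

/-! ### The Clifford algebra, the spin group and its algebra of polynomial functions -/

/-- The standard Euclidean quadratic form `x ↦ ∑ i, x i ^ 2` on `ℝⁿ`. -/
def euclideanForm (n : ℕ) : QuadraticForm ℝ (Fin n → ℝ) :=
  QuadraticMap.weightedSumSquares ℝ (fun _ : Fin n => (1 : ℝ))

/-- The real Clifford algebra of Euclidean space, `x * x = |x|²`; the spin group lives in it. -/
abbrev Cl (n : ℕ) := CliffordAlgebra (euclideanForm n)

/-- The (compact) spin group. -/
abbrev Spin (n : ℕ) := spinGroup (euclideanForm n)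

/-- The exterior algebra of `ℂⁿ`. -/
abbrev Ext (n : ℕ) := ExteriorAlgebra ℂ (Fin n → ℂ)

instance finite_Cl (n : ℕ) : Module.Finite ℝ (Cl n) :=
  haveI : Module.Finite ℝ (ExteriorAlgebra ℝ (Fin n → ℝ)) :=
    Module.Finite.of_basis (Pi.basisFun ℝ (Fin n)).ExteriorAlgebra
  Module.Finite.equiv (CliffordAlgebra.equivExterior (euclideanForm n)).symm

/-- The *-algebra of complex polynomial functions on the spin group: it is generated by the
restrictions of the linear functionals on the ambient Clifford algebra. -/
def polyFun (n : ℕ) : StarSubalgebra ℂ (Spin n → ℂ) :=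
  StarAlgebra.adjoin ℂ {f | ∃ L : Cl n →ₗ[ℝ] ℂ, ∀ g, f g = L (g : Cl n)}

/-- The commutative *-algebra `𝒮ₙ` of polynomial functions on the spin group. -/
abbrev Sn (n : ℕ) := ↥(polyFun n)

/-- The linear functional `L` on the Clifford algebra as an element of `𝒮ₙ`. -/
def linFun {n : ℕ} (L : Cl n →ₗ[ℝ] ℂ) : Sn n :=
  ⟨fun g => L (g : Cl n), StarAlgebra.subset_adjoin ℂ _ ⟨L, fun _ => rfl⟩⟩

/-- Evaluation of polynomial functions at a point of the spin group. -/
def evalAt {n : ℕ} (g : Spin n) : Sn n →ₐ[ℂ] ℂ :=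
  (Pi.evalAlgHom ℂ (fun _ : Spin n => ℂ) g).comp (polyFun n).subtype.toAlgHom

/-- The counit `ε` of `𝒮ₙ`: evaluation at the neutral element. -/
def counit (n : ℕ) : Sn n →ₐ[ℂ] ℂ := evalAt 1

/-- The map `a ⊗ b ↦ ((g, h) ↦ a g * b h)`. -/
def prodFun (n : ℕ) : Sn n ⊗[ℂ] Sn n →ₐ[ℂ] (Spin n × Spin n → ℂ) :=
  AlgHom.pi fun p => Algebra.TensorProduct.lift (evalAt p.1) (evalAt p.2)
    fun _ _ => Commute.all _ _

@[simp] lemma prodFun_tmul {n : ℕ} (a b : Sn n) (p : Spin n × Spin n) :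
    prodFun n (a ⊗ₜ b) p = a.1 p.1 * b.1 p.2 := rfl

lemma prodFun_injective (n : ℕ) : Function.Injective (prodFun n) := by
  rw [injective_iff_map_eq_zero]
  intro t ht
  classical
  let b := Module.Basis.ofVectorSpace ℂ (Sn n)
  obtain ⟨c, rfl⟩ := (TensorProduct.equivFinsuppOfBasisRight (M := Sn n) b).symm.surjective t
  suffices c = 0 by rw [this, map_zero]
  rw [TensorProduct.equivFinsuppOfBasisRight_symm_apply] at ht
  ext i g
  have key : (c.sum fun i m => m.1 g • b i) = 0 := by
    ext h
    have := congrFun ht (g, h)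
    simp only [Finsupp.sum, map_sum, Finset.sum_apply, prodFun_tmul] at this
    simpa [Finsupp.sum, Finset.sum_apply] using this
  have := linearIndependent_iff'.mp b.linearIndependent c.support (fun i => (c i).1 g)
    (by simpa [Finsupp.sum] using key) i
  by_cases hi : i ∈ c.support
  · simpa using this hi
  · rw [Finsupp.notMem_support_iff.mp hi]
    rfl

/-- The pullback `a ↦ ((g, h) ↦ a (g * h))`. -/
def mulPullback (n : ℕ) : Sn n →ₐ[ℂ] (Spin n × Spin n → ℂ) :=
  AlgHom.pi fun p => evalAt (p.1 * p.2)

lemma mulPullback_mem (n : ℕ) (a : Sn n) : mulPullback n a ∈ (prodFun n).range := by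
  obtain ⟨a, ha⟩ := a
  induction ha using StarAlgebra.adjoin_induction with
  | mem x h =>
    obtain ⟨L, hL⟩ := h
    let b := Module.finBasis ℝ (Cl n)
    refine ⟨∑ k, linFun (Complex.ofRealAm.toLinearMap ∘ₗ b.coord k) ⊗ₜ
      linFun (L ∘ₗ LinearMap.mulLeft ℝ (b k)), ?_⟩
    funext p
    change prodFun n _ p = x (p.1 * p.2)
    rw [hL, map_sum, Finset.sum_apply]
    simp only [prodFun_tmul, linFun]
    have h1 : ((p.1 * p.2 : Spin n) : Cl n) = ∑ k, b.repr (p.1 : Cl n) k • (b k * (p.2 : Cl n)) := by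
      conv_lhs => rw [Submonoid.coe_mul, ← b.sum_repr (p.1 : Cl n), Finset.sum_mul]
      simp
    rw [h1, map_sum]
    simp
  | algebraMap r => exact (prodFun n).range.algebraMap_mem r
  | add x y hx hy h1 h2 => exact add_mem h1 h2
  | mul x y hx hy h1 h2 => exact mul_mem h1 h2
  | star x hx h =>
    obtain ⟨t, ht⟩ := h
    refine ⟨star t, ?_⟩
    have hs : ∀ t, prodFun n (star t) = star (prodFun n t) := by
      intro t
      induction t using TensorProduct.induction_on with
      | zero => simp
      | tmul a b =>
        funext p
        change prodFun n (star a ⊗ₜ star b) p = star (prodFun n (a ⊗ₜ b) p)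
        rw [prodFun_tmul, prodFun_tmul, star_mul']
        rfl
      | add x y h1 h2 => rw [star_add, map_add, map_add, star_add, h1, h2]
    have ht' : prodFun n t = mulPullback n ⟨x, hx⟩ := ht
    change prodFun n (star t) = _
    rw [hs, ht']
    rfl

/-- The coproduct `φ : 𝒮ₙ → 𝒮ₙ ⊗ 𝒮ₙ`, dual to the multiplication of the spin group. -/
def comul (n : ℕ) : Sn n →ₐ[ℂ] Sn n ⊗[ℂ] Sn n :=
  ((AlgEquiv.ofInjective (prodFun n) (prodFun_injective n)).symm : _ →ₐ[ℂ] _).comp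
    ((mulPullback n).codRestrict (prodFun n).range (mulPullback_mem n))

/-- `comul a` is characterised by `φ(a)(g, h) = a (g h)`. -/
lemma prodFun_comul {n : ℕ} (a : Sn n) (g h : Spin n) :
    prodFun n (comul n a) (g, h) = a.1 (g * h) := by
  have := AlgEquiv.apply_symm_apply (AlgEquiv.ofInjective (prodFun n) (prodFun_injective n))
    ((mulPullback n).codRestrict (prodFun n).range (mulPullback_mem n) a)
  exact congrFun (congrArg Subtype.val this) (g, h)

/-! ### The vector representation -/

/-- The degree-one (vector) part of an element of the Clifford algebra. -/
def vecPart (n : ℕ) : Cl n →ₗ[ℝ] (Fin n → ℝ) :=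
  ExteriorAlgebra.ιInv ∘ₗ (CliffordAlgebra.equivExterior (euclideanForm n)).toLinearMap

lemma vecPart_ι {n : ℕ} (x : Fin n → ℝ) : vecPart n (CliffordAlgebra.ι _ x) = x := by
  have h : CliffordAlgebra.equivExterior (euclideanForm n) (CliffordAlgebra.ι _ x) =
      ExteriorAlgebra.ι ℝ x := CliffordAlgebra.changeForm_ι
      CliffordAlgebra.changeForm.associated_neg_proof _
  change ExteriorAlgebra.ιInv (CliffordAlgebra.equivExterior (euclideanForm n) _) = x
  rw [h]
  exact ExteriorAlgebra.ι_leftInverse x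

/-- The matrix element `u j i` of the representation `x ↦ g x g⁻¹` of the spin group in `ℂⁿ`,
as a function on the spin group. -/
def vecFun (n : ℕ) (j i : Fin n) : Spin n → ℂ := fun g =>
  ((vecPart n ((g : Cl n) * CliffordAlgebra.ι _ (Pi.single i 1) * ((g⁻¹ : Spin n) : Cl n)) j : ℝ) : ℂ)

/-- `g eᵢ g⁻¹ = ∑ⱼ u j i (g) eⱼ`. -/
lemma conj_ι {n : ℕ} (g : Spin n) (i : Fin n) :
    ∃ x : Fin n → ℝ, (g : Cl n) * CliffordAlgebra.ι _ (Pi.single i 1) * ((g⁻¹ : Spin n) : Cl n)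
      = CliffordAlgebra.ι _ x ∧ ∀ j, vecFun n j i g = x j := by
  have h := spinGroup.conjAct_smul_ι_mem_range_ι (x := spinGroup.toUnits g) g.2
    (Pi.single i (1 : ℝ))
  obtain ⟨x, hx⟩ := h
  rw [ConjAct.units_smul_def, ConjAct.ofConjAct_toConjAct] at hx
  have hx' : (g : Cl n) * CliffordAlgebra.ι _ (Pi.single i 1) * ((g⁻¹ : Spin n) : Cl n)
      = CliffordAlgebra.ι _ x := hx.symm
  refine ⟨x, hx', fun j => ?_⟩
  rw [vecFun, hx', vecPart_ι]

lemma vecFun_mem (n : ℕ) (j i : Fin n) : vecFun n j i ∈ polyFun n := by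
  let b := Module.finBasis ℝ (Cl n)
  let st : Cl n →ₗ[ℝ] Cl n :=
    { toFun := star, map_add' := star_add, map_smul' := fun r x => CliffordAlgebra.star_smul r x }
  let e : Cl n := CliffordAlgebra.ι _ (Pi.single i 1)
  let c : Cl n →ₗ[ℝ] ℂ := Complex.ofRealAm.toLinearMap ∘ₗ LinearMap.proj j ∘ₗ vecPart n
  have h : vecFun n j i = ((∑ k, linFun (Complex.ofRealAm.toLinearMap ∘ₗ b.coord k) *
      linFun (c ∘ₗ LinearMap.mulLeft ℝ (b k * e) ∘ₗ st) : Sn n) : Spin n → ℂ) := by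
    funext g
    have h1 : (g : Cl n) * e * star (g : Cl n) =
        ∑ k, b.repr (g : Cl n) k • (b k * e * star (g : Cl n)) := by
      conv_lhs => rw [← b.sum_repr (g : Cl n), Finset.sum_mul, Finset.sum_mul]
      simp
    have h2 : vecFun n j i g = c ((g : Cl n) * e * star (g : Cl n)) := rfl
    rw [h2, h1, map_sum, AddSubmonoidClass.coe_finsetSum, Finset.sum_apply]
    simp [linFun, st, mul_assoc]
  rw [h]
  exact Subtype.property _

/-- The matrix elements `u j i ∈ 𝒮ₙ` of the vector representation. -/
def u (n : ℕ) (j i : Fin n) : Sn n := ⟨vecFun n j i, vecFun_mem n j i⟩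

/-- The basis vector `eᵢ` in the exterior algebra of `ℂⁿ`. -/
def e {n : ℕ} (i : Fin n) : Ext n := ExteriorAlgebra.ι ℂ (Pi.single i 1)

/-- The comodule map `u : ℂⁿ → ℂⁿ ⊗ 𝒮ₙ`, `eᵢ ↦ ∑ⱼ eⱼ ⊗ u j i`, with values in `Λℂⁿ ⊗ 𝒮ₙ`. -/
def uVec (n : ℕ) : (Fin n → ℂ) →ₗ[ℂ] Ext n ⊗[ℂ] Sn n :=
  (Pi.basisFun ℂ (Fin n)).constr ℂ fun i => ∑ j, e j ⊗ₜ u n j i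

lemma uVec_sq {n : ℕ} (x : Fin n → ℂ) : uVec n x * uVec n x = 0 := by
  have h : ∃ s : Fin n → Sn n, uVec n x = ∑ j, e j ⊗ₜ[ℂ] s j := by
    refine ⟨fun j => ∑ i, x i • u n j i, ?_⟩
    rw [uVec, Module.Basis.constr_apply_fintype]
    simp only [Pi.basisFun_equivFun, LinearEquiv.refl_apply, Finset.smul_sum,
      TensorProduct.tmul_sum, TensorProduct.tmul_smul]
    exact Finset.sum_comm
  obtain ⟨s, hs⟩ := h
  have h1 : uVec n x * uVec n x = -(uVec n x * uVec n x) := by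
    conv_lhs => rw [hs, Finset.sum_mul_sum, Finset.sum_comm]
    rw [hs, Finset.sum_mul_sum, ← Finset.sum_neg_distrib]
    refine Finset.sum_congr rfl fun j _ => ?_
    rw [← Finset.sum_neg_distrib]
    refine Finset.sum_congr rfl fun k _ => ?_
    rw [Algebra.TensorProduct.tmul_mul_tmul, Algebra.TensorProduct.tmul_mul_tmul, mul_comm (s k),
      ← TensorProduct.neg_tmul]
    congr 1
    exact eq_neg_of_add_eq_zero_left (ExteriorAlgebra.ι_add_mul_swap _ _)
  have h2 : (2 : ℂ) • (uVec n x * uVec n x) = 0 := by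
    rw [two_smul]
    nth_rewrite 1 [h1]
    exact neg_add_cancel _
  exact (smul_eq_zero.mp h2).resolve_left two_ne_zero

/-- The extension `u^∧ : Λℂⁿ → Λℂⁿ ⊗ 𝒮ₙ` of `u` to the exterior algebra. -/
def uExt (n : ℕ) : Ext n →ₐ[ℂ] Ext n ⊗[ℂ] Sn n :=
  ExteriorAlgebra.lift ℂ ⟨uVec n, uVec_sq⟩

/-! ### The Hodge operator and the components of a two-vector -/

/-- The standard basis of `Λℂⁿ`: the increasing products of the `eᵢ`. -/
def extBasis (n : ℕ) : Module.Basis (Finset (Fin n)) ℂ (Ext n) :=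
  (Pi.basisFun ℂ (Fin n)).ExteriorAlgebra

/-- The Hodge operator on `Λℂⁿ`: `⋆ e_I = s • e_{Iᶜ}`, where the sign `s` is given by
`e_I ∧ e_{Iᶜ} = s • (e₁ ∧ ⋯ ∧ eₙ)`. -/
def hodge (n : ℕ) : Ext n →ₗ[ℂ] Ext n :=
  (extBasis n).constr ℂ fun I =>
    (extBasis n).repr (extBasis n I * extBasis n Iᶜ) Finset.univ • extBasis n Iᶜ

/-- The defining property of the Hodge operator. -/
lemma extBasis_mul_hodge {n : ℕ} (I : Finset (Fin n)) :
    extBasis n I * hodge n (extBasis n I) = extBasis n Finset.univ := by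
  have hd : Disjoint (⟨I, rfl⟩ : Set.powersetCard (Fin n) I.card).val
      (⟨Iᶜ, rfl⟩ : Set.powersetCard (Fin n) Iᶜ.card).val := disjoint_compl_right
  have h := ExteriorAlgebra.basis_mul_of_disjoint (Pi.basisFun ℂ (Fin n)) _ _ hd
  have hu : (Set.powersetCard.disjUnion hd).val = Finset.univ := by
    simp [Set.powersetCard.disjUnion]
  rw [hu] at h
  change extBasis n I * extBasis n Iᶜ = _ • extBasis n Finset.univ at h
  rw [hodge, Module.Basis.constr_basis, mul_smul_comm, h]
  rcases Int.units_eq_one_or (Set.powersetCard.permOfDisjoint hd).sign with hs | hs <;>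
    simp [hs]

/-- The coefficient `w i j` of `w = 1/2 ∑ w i j • eᵢ ∧ eⱼ` (with `w j i = - w i j`), obtained by
contracting first with the dual vector of `eᵢ`, then with that of `eⱼ`. -/
def comp2 (n : ℕ) (i j : Fin n) : Ext n →ₗ[ℂ] ℂ :=
  (ExteriorAlgebra.algebraMapInv : Ext n →ₐ[ℂ] ℂ).toLinearMap ∘ₗ
    CliffordAlgebra.contractLeft (LinearMap.proj j : (Fin n → ℂ) →ₗ[ℂ] ℂ) ∘ₗ
    CliffordAlgebra.contractLeft (LinearMap.proj i : (Fin n → ℂ) →ₗ[ℂ] ℂ)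

/-! ### Algebraic spinors -/

/-- The space of algebraic spinors: the exterior algebra of `V₊ = ℂʳ`, `r = ⌊n / 2⌋`, whose
standard basis stands for the vectors `f j = (e (2j) + i e (2j+1)) / √2` of `ℂⁿ` (indices
from `0`). -/
abbrev Spinor (n : ℕ) := ExteriorAlgebra ℂ (Fin (n / 2) → ℂ)

/-- The component of `√2 x` in `V₊`, in the basis `f j`. -/
def plusPart (n : ℕ) : (Fin n → ℂ) →ₗ[ℂ] (Fin (n / 2) → ℂ) :=
  LinearMap.pi fun j =>
    LinearMap.proj (⟨2 * j.1, by omega⟩ : Fin n) -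
      Complex.I • LinearMap.proj (⟨2 * j.1 + 1, by omega⟩ : Fin n)

/-- The component of `√2 x` in `V₋`, which is spanned by the complex conjugates of the `f j`, as
the linear form that it defines on `V₊`. -/
def minusPart (n : ℕ) : (Fin n → ℂ) →ₗ[ℂ] Module.Dual ℂ (Fin (n / 2) → ℂ) :=
  ∑ j : Fin (n / 2),
    (LinearMap.proj (⟨2 * j.1, by omega⟩ : Fin n) +
      Complex.I • LinearMap.proj (⟨2 * j.1 + 1, by omega⟩ : Fin n)).smulRight
      (LinearMap.proj j : (Fin (n / 2) → ℂ) →ₗ[ℂ] ℂ)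

/-- The last coordinate of `x` if `n` is odd, and zero if `n` is even. -/
def lastPart (n : ℕ) : (Fin n → ℂ) →ₗ[ℂ] ℂ :=
  if h : n % 2 = 1 then LinearMap.proj (⟨n - 1, by omega⟩ : Fin n) else 0

/-- The Clifford action of `x ∈ ℂⁿ` on spinors: `x ξ = x₊ ∧ ξ + x₋ ⌟ ξ`; if `n` is odd then the
last basis vector acts as the parity operator. -/
def cliffordAction (n : ℕ) : (Fin n → ℂ) →ₗ[ℂ] Module.End ℂ (Spinor n) :=
  LinearMap.mul ℂ (Spinor n) ∘ₗ ExteriorAlgebra.ι ℂ ∘ₗ plusPart n +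
    CliffordAlgebra.contractLeft ∘ₗ minusPart n +
    (lastPart n).smulRight (CliffordAlgebra.involute : Spinor n →ₐ[ℂ] Spinor n).toLinearMap

lemma involute_contractLeft {V : Type*} [AddCommGroup V] [Module ℂ V] (d : Module.Dual ℂ V)
    (ξ : ExteriorAlgebra ℂ V) :
    CliffordAlgebra.involute (CliffordAlgebra.contractLeft d ξ) =
      -CliffordAlgebra.contractLeft d (CliffordAlgebra.involute ξ) := by
  induction ξ using CliffordAlgebra.left_induction with
  | algebraMap r => simp
  | add x y hx hy => simp only [map_add, hx, hy, neg_add]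
  | ι_mul x m hx =>
    rw [CliffordAlgebra.contractLeft_ι_mul, map_sub, map_smul, map_mul, map_mul, hx,
      CliffordAlgebra.involute_ι, neg_mul, neg_mul, map_neg, CliffordAlgebra.contractLeft_ι_mul]
    simp only [mul_neg]
    abel

lemma sum_coord (n : ℕ) (x : Fin n → ℂ) :
    minusPart n x (plusPart n x) + lastPart n x * lastPart n x = ∑ i, x i * x i := by
  have h1 : minusPart n x (plusPart n x) = ∑ j : Fin (n / 2),
      (x ⟨2 * j.1, by omega⟩ * x ⟨2 * j.1, by omega⟩ +
        x ⟨2 * j.1 + 1, by omega⟩ * x ⟨2 * j.1 + 1, by omega⟩) := by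
    simp only [minusPart, plusPart, LinearMap.sum_apply, LinearMap.smulRight_apply,
      LinearMap.smul_apply, LinearMap.add_apply, LinearMap.proj_apply, LinearMap.pi_apply,
      LinearMap.sub_apply, smul_eq_mul]
    refine Finset.sum_congr rfl fun j _ => ?_
    linear_combination -(x ⟨2 * j.1 + 1, by omega⟩ * x ⟨2 * j.1 + 1, by omega⟩) * Complex.I_mul_I
  let y : ℕ → ℂ := fun k => if h : k < n then x ⟨k, h⟩ * x ⟨k, h⟩ else 0
  have h2 : ∀ m, ∑ j ∈ Finset.range m, (y (2 * j) + y (2 * j + 1)) =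
      ∑ k ∈ Finset.range (2 * m), y k := by
    intro m
    induction m with
    | zero => simp
    | succ m ih =>
      rw [Finset.sum_range_succ, ih, show 2 * (m + 1) = 2 * m + 1 + 1 by ring,
        Finset.sum_range_succ, Finset.sum_range_succ]
      ring
  have h3 : ∑ i, x i * x i = ∑ k ∈ Finset.range n, y k := by
    rw [Finset.sum_range]
    exact Finset.sum_congr rfl fun i _ => by simp [y]
  have h4 : minusPart n x (plusPart n x) = ∑ k ∈ Finset.range (2 * (n / 2)), y k := by
    rw [h1, ← h2, Finset.sum_range]
    refine Finset.sum_congr rfl fun j _ => ?_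
    have := j.2
    simp only [y]
    rw [dif_pos (by omega), dif_pos (by omega)]
  rw [h3, h4]
  by_cases h : n % 2 = 1
  · have hn : n = 2 * (n / 2) + 1 := by omega
    have h5 : lastPart n x * lastPart n x = y (2 * (n / 2)) := by
      simp only [lastPart, dif_pos h, LinearMap.proj_apply, y]
      rw [dif_pos (by omega)]
      have : (⟨n - 1, by omega⟩ : Fin n) = ⟨2 * (n / 2), by omega⟩ := Fin.ext (by simp; omega)
      rw [this]
    rw [h5, ← Finset.sum_range_succ, ← hn]
  · have hn : 2 * (n / 2) = n := by omega
    simp [lastPart, h, hn]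

/-- The Clifford relation `x (x ξ) = (∑ xᵢ²) ξ`. -/
lemma cliffordAction_sq {n : ℕ} (x : Fin n → ℂ) :
    cliffordAction n x * cliffordAction n x = algebraMap ℂ _ (∑ i, x i * x i) := by
  refine LinearMap.ext fun ξ => ?_
  rw [← sum_coord, Module.algebraMap_end_apply, add_smul]
  have ha : ∀ ξ, cliffordAction n x ξ = ExteriorAlgebra.ι ℂ (plusPart n x) * ξ +
      CliffordAlgebra.contractLeft (minusPart n x) ξ +
      lastPart n x • CliffordAlgebra.involute ξ := fun _ => rfl
  rw [Module.End.mul_apply, ha (cliffordAction n x ξ), ha ξ]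
  simp only [mul_add, map_add, map_smul, map_mul, involute_contractLeft,
    CliffordAlgebra.contractLeft_ι_mul, CliffordAlgebra.involute_ι,
    CliffordAlgebra.involute_involute, CliffordAlgebra.contractLeft_contractLeft,
    ← mul_assoc, ExteriorAlgebra.ι_sq_zero, smul_add, mul_smul_comm, smul_smul, zero_mul, neg_mul, smul_neg]
  abel

/-- The operators `γᵢ` on spinors representing the basis vectors `eᵢ`. -/
def γ {n : ℕ} (i : Fin n) : Module.End ℂ (Spinor n) := cliffordAction n (Pi.single i 1)

/-- The action of the Clifford algebra on spinors. -/
def cliffordRep (n : ℕ) : Cl n →ₐ[ℝ] Module.End ℂ (Spinor n) :=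
  CliffordAlgebra.lift (euclideanForm n)
    ⟨(cliffordAction n).restrictScalars ℝ ∘ₗ Complex.ofRealAm.toLinearMap.compLeft (Fin n), by
      intro x
      change cliffordAction n (fun i => (x i : ℂ)) * cliffordAction n (fun i => (x i : ℂ)) = _
      rw [cliffordAction_sq]
      have : (∑ i, (x i : ℂ) * (x i : ℂ)) = ((euclideanForm n x : ℝ) : ℂ) := by
        simp [euclideanForm, QuadraticMap.weightedSumSquares_apply]
      rw [this]
      rfl⟩

/-- The orthonormal basis `σ_I` of the space of spinors: the increasing products of the `f j`,
`j ∈ I`. -/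
def σ (n : ℕ) : Module.Basis (Finset (Fin (n / 2))) ℂ (Spinor n) :=
  (Pi.basisFun ℂ (Fin (n / 2))).ExteriorAlgebra

/-- The matrix elements of the spin representation, `U(g) σ_I = ∑_J U J I (g) σ_J`. -/
def U (n : ℕ) (J I : Finset (Fin (n / 2))) : Sn n :=
  linFun (((σ n).coord J).restrictScalars ℝ ∘ₗ
    (LinearMap.applyₗ (R := ℂ) (σ n I)).restrictScalars ℝ ∘ₗ (cliffordRep n).toLinearMap)

/-- The spin representation as a comodule map `U : 𝕊 → 𝕊 ⊗ 𝒮ₙ`. -/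
def spinCoaction (n : ℕ) : Spinor n →ₗ[ℂ] Spinor n ⊗[ℂ] Sn n :=
  (σ n).constr ℂ fun I => ∑ J, σ n J ⊗ₜ U n J I

/-! ### Quantum principal spin-bundles and frame structures -/

/-- A quantum principal `Spin(n)`-bundle `P = (B, i, F)` over the quantum space represented by the
*-algebra `V`. -/
structure SpinBundle (n : ℕ) (V B : Type*) [Ring V] [Algebra ℂ V] [StarRing V] [StarModule ℂ V]
    [Ring B] [Algebra ℂ B] [StarRing B] [StarModule ℂ B] where
  /-- the dualized projection -/
  i : V →⋆ₐ[ℂ] B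
  /-- the dualized right action -/
  F : B →⋆ₐ[ℂ] B ⊗[ℂ] Sn n
  i_injective : Function.Injective i
  coassoc : ∀ b, TensorProduct.assoc ℂ B (Sn n) (Sn n)
      (TensorProduct.map F.toAlgHom.toLinearMap LinearMap.id (F b)) =
    TensorProduct.map LinearMap.id (comul n).toLinearMap (F b)
  counit_F : ∀ b, TensorProduct.rid ℂ B
      (TensorProduct.map LinearMap.id (counit n).toLinearMap (F b)) = b
  mem_range_i : ∀ b, (∃ f, i f = b) ↔ F b = b ⊗ₜ 1
  free : ∀ a : Sn n, ∃ (m : ℕ) (q b : Fin m → B), ∑ k, (q k ⊗ₜ 1) * F (b k) = 1 ⊗ₜ a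

variable {n : ℕ} {V B : Type*} [Ring V] [Algebra ℂ V] [StarRing V] [StarModule ℂ V]
  [Ring B] [Algebra ℂ B] [StarRing B] [StarModule ℂ B]

/-- A frame structure `(∂₁, …, ∂ₙ)` on a quantum principal `Spin(n)`-bundle. -/
structure FrameStructure (P : SpinBundle n V B) where
  del : Fin n → V →ₗ[ℂ] B
  del_mul : ∀ i f g, del i (f * g) = del i f * P.i g + P.i f * del i g
  del_star : ∀ i f, del i (star f) = star (del i f)
  F_del : ∀ i f, P.F (del i f) = ∑ j, del j f ⊗ₜ u n j i
  complete : ∃ (m : ℕ) (b : Fin n → Fin m → B) (v : Fin n → Fin m → V),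
    ∀ i j, ∑ α, b i α * del j (v i α) = if i = j then 1 else 0

/-- A system `(X₁, …, Xₙ)` of hermitian derivations of `B` which makes the frame structure
integrable. -/
structure IntegrableSystem {P : SpinBundle n V B} (τ : FrameStructure P) where
  X : Fin n → B →ₗ[ℂ] B
  X_mul : ∀ i b c, X i (b * c) = X i b * c + b * X i c
  X_star : ∀ i b, X i (star b) = star (X i b)
  X_i : ∀ i f, X i (P.i f) = τ.del i f
  torsion_free : ∀ i j f, X i (τ.del j f) - X j (τ.del i f) = 0
  F_X : ∀ i b, P.F (X i b) =
    ∑ j, TensorProduct.map (X j) (LinearMap.mulLeft ℂ (u n j i)) (P.F b)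

/-! ### Horizontal forms, covariant derivative, curvature -/

/-- The algebra of horizontal forms `B ⊗ Λℂⁿ`. -/
abbrev Hor (n : ℕ) (B : Type*) [Ring B] [Algebra ℂ B] := B ⊗[ℂ] Ext n

/-- The covariant derivative `∇(b ⊗ ϑ) = ∑ₖ Xₖ(b) ⊗ (eₖ ∧ ϑ)`. -/
def nabla (X : Fin n → B →ₗ[ℂ] B) : Hor n B →ₗ[ℂ] Hor n B :=
  ∑ k, TensorProduct.map (X k) (LinearMap.mulLeft ℂ (e k))

/-- The action `F^⋆(b ⊗ ϑ) = F(b) u^∧(ϑ)` on horizontal forms. -/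
def horCoaction (F : B →ₗ[ℂ] B ⊗[ℂ] Sn n) : Hor n B →ₗ[ℂ] Hor n B ⊗[ℂ] Sn n :=
  TensorProduct.lift ((LinearMap.mul ℂ (Hor n B ⊗[ℂ] Sn n)).compl₁₂
    (TensorProduct.map (Algebra.TensorProduct.includeLeft : B →ₐ[ℂ] Hor n B).toLinearMap
      LinearMap.id ∘ₗ F)
    (TensorProduct.map (Algebra.TensorProduct.includeRight : Ext n →ₐ[ℂ] Hor n B).toLinearMap
      LinearMap.id ∘ₗ (uExt n).toLinearMap))

/-- `ϱ` is the curvature: `∇²(φ) = -∑ₖ φₖ ϱ(cₖ)` for all `φ`, where `F^⋆(φ) = ∑ₖ φₖ ⊗ cₖ`. -/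
def IsCurvature (P : SpinBundle n V B) (X : Fin n → B →ₗ[ℂ] B) (ϱ : Sn n →ₗ[ℂ] Hor n B) : Prop :=
  ∀ φ : Hor n B, nabla X (nabla X φ) =
    -LinearMap.mul' ℂ (Hor n B)
      (TensorProduct.map LinearMap.id ϱ (horCoaction P.F.toAlgHom.toLinearMap φ))

/-- The curvature is classical: `ϱ(ab) = ε(a)ϱ(b) + ε(b)ϱ(a)`. -/
def IsClassical (ϱ : Sn n →ₗ[ℂ] Hor n B) : Prop :=
  ∀ a b, ϱ (a * b) = counit n a • ϱ b + counit n b • ϱ a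

/-- The components `ϱ_{ij} : 𝒮ₙ → B` in `ϱ(a) = 1/2 ∑_{ij} ϱ_{ij}(a) ⊗ (eᵢ ∧ eⱼ)`. -/
def curvComp (ϱ : Sn n →ₗ[ℂ] Hor n B) (i j : Fin n) : Sn n →ₗ[ℂ] B :=
  (TensorProduct.rid ℂ B).toLinearMap ∘ₗ TensorProduct.map LinearMap.id (comp2 n i j) ∘ₗ ϱ

/-- The Hodge operator on horizontal forms. -/
def horHodge (n : ℕ) (B : Type*) [Ring B] [Algebra ℂ B] : Hor n B →ₗ[ℂ] Hor n B :=
  TensorProduct.map LinearMap.id (hodge n)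

/-- The operator which multiplies horizontal `k`-forms by `(-1) ^ (n k)`. -/
def degSign (n : ℕ) (B : Type*) [Ring B] [Algebra ℂ B] : Hor n B →ₗ[ℂ] Hor n B :=
  TensorProduct.map LinearMap.id
    ((CliffordAlgebra.involute : Ext n →ₐ[ℂ] Ext n).toLinearMap ^ n)

/-- The codifferential: `∇†(φ) = -(-1) ^ (n - n k) ⋆ ∇ ⋆ φ` for horizontal `k`-forms `φ`. -/
def nablaDagger (X : Fin n → B →ₗ[ℂ] B) : Hor n B →ₗ[ℂ] Hor n B :=
  -((-1 : ℂ) ^ n • (horHodge n B ∘ₗ nabla X ∘ₗ horHodge n B ∘ₗ degSign n B))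

/-! ### Spinor fields -/

/-- The product of a coaction on `A` and the spin representation, as a coaction on `A ⊗ 𝕊`:
`a ⊗ s ↦ ∑ a₀ ⊗ s₀ ⊗ a₁ s₁`. -/
def prodCoaction {A : Type*} [AddCommGroup A] [Module ℂ A] (F : A →ₗ[ℂ] A ⊗[ℂ] Sn n) :
    A ⊗[ℂ] Spinor n →ₗ[ℂ] (A ⊗[ℂ] Spinor n) ⊗[ℂ] Sn n :=
  TensorProduct.map LinearMap.id (LinearMap.mul' ℂ (Sn n)) ∘ₗ
    (TensorProduct.tensorTensorTensorComm ℂ A (Sn n) (Spinor n) (Sn n)).toLinearMap ∘ₗ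
    TensorProduct.map F (spinCoaction n)

/-- The space `𝓔` of sections of the associated spinor bundle: the elements of `B ⊗ 𝕊` which are
invariant under the product of the actions `F` and `U`. -/
def sections (P : SpinBundle n V B) : Submodule ℂ (B ⊗[ℂ] Spinor n) :=
  LinearMap.ker (prodCoaction P.F.toAlgHom.toLinearMap -
    (TensorProduct.mk ℂ (B ⊗[ℂ] Spinor n) (Sn n)).flip 1)

/-- Spinor fields as spinor-valued horizontal forms of degree zero. -/
def toForms (n : ℕ) (B : Type*) [Ring B] [Algebra ℂ B] :
    B ⊗[ℂ] Spinor n →ₗ[ℂ] Hor n B ⊗[ℂ] Spinor n :=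
  TensorProduct.map (Algebra.TensorProduct.includeLeft : B →ₐ[ℂ] Hor n B).toLinearMap
    LinearMap.id

/-- The spinor Laplacian `Δ_E = ∇_E ∇_E† + ∇_E† ∇_E`, where `∇_E = ∇ ⊗ id`, `∇_E† = ∇† ⊗ id`. -/
def laplacian (X : Fin n → B →ₗ[ℂ] B) :
    Hor n B ⊗[ℂ] Spinor n →ₗ[ℂ] Hor n B ⊗[ℂ] Spinor n :=
  (nabla X).rTensor (Spinor n) ∘ₗ (nablaDagger X).rTensor (Spinor n) +
    (nablaDagger X).rTensor (Spinor n) ∘ₗ (nabla X).rTensor (Spinor n)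

/-- The Dirac operator `D_E(ψ) = -i ∑_{iI} Xᵢ(ψ_I) ⊗ γᵢ σ_I`. -/
def dirac (X : Fin n → B →ₗ[ℂ] B) : B ⊗[ℂ] Spinor n →ₗ[ℂ] B ⊗[ℂ] Spinor n :=
  -(Complex.I • ∑ i, TensorProduct.map (X i) (γ i))

/-- The coefficient `ψ_I ∈ B` of `ψ = ∑_I ψ_I ⊗ σ_I`. -/
def coeff (I : Finset (Fin (n / 2))) : B ⊗[ℂ] Spinor n →ₗ[ℂ] B :=
  (TensorProduct.rid ℂ B).toLinearMap ∘ₗ TensorProduct.map LinearMap.id ((σ n).coord I)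

/-- The curvature operator
`ϱ_E(ψ) = -1/2 ∑_{ijIJ} ψ_I ϱ_{ij}(U J I) ⊗ γᵢ γⱼ σ_J`. -/
def curvOp (ϱ : Sn n →ₗ[ℂ] Hor n B) : B ⊗[ℂ] Spinor n →ₗ[ℂ] B ⊗[ℂ] Spinor n :=
  -((1 / 2 : ℂ) • ∑ i, ∑ j, ∑ I, ∑ J,
    (TensorProduct.mk ℂ B (Spinor n)).flip (γ i (γ j (σ n J))) ∘ₗ
      LinearMap.mulRight ℂ (curvComp ϱ i j (U n J I)) ∘ₗ coeff I)

end QSpin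

end

noncomputable section

namespace QSpin

set_option linter.unusedSectionVars false

/-! ### A faithful orthogonal representation of the Clifford algebra -/

/-! An element of `M ⊗ 𝒮ₙ` is determined by its values at the points of Spin(n) (`evalTensor_ext`),
so F amounts to an action of Spin(n) on B by algebra automorphisms, and identities involving F can
be checked point by point.

Curvature. On B, ∇² obeys the Leibniz rule, since the cross terms are symmetric in two indices and
vanish under the wedge product; it kills V because the torsion is zero. Hence it is left V-linear.
For a free action such a map has the form b ↦ Σ b₀ r(b₁) (`exists_factor`), and ϱ = −r. The proof
averages over a compact group in which the spin group is dense, which requires a faithful orthogonal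
representation. Freeness alone gives uniqueness (`exists_apply_eq_sum`). Passing from B to all
horizontal forms is the first Bianchi identity Σₖ ϱ(u_{ki} a) eₖ = ϱ(a) eᵢ (`bianchi`), which comes
from ∇³f = 0 for f in V and the completeness of the frame.

Lichnerowicz formula. On spinor fields the Laplacian is −Σ Xᵢ² (`laplacian_toForms`). In D² = −Σ
XᵢXⱼ ⊗ γᵢγⱼ the Clifford relations separate −Σ Xᵢ² from the commutators [Xᵢ, Xⱼ], which are the
components of ∇². Invariance of ψ says Σ_I F(ψ_I)(1 ⊗ U_{JI}) = ψ_J ⊗ 1. A classical ϱ acts on this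
product as a derivation, which yields ∇²ψ_J = Σ_I ψ_I ϱ(U_{JI}) (`IsClassical.convolve_F_coeff`),
and the commutator term becomes ϱ_E. -/

/-- The sign of the Jordan–Wigner matrices. -/
def jwSign {n : ℕ} (i : Fin n) (I : Finset (Fin n)) : ℝ :=
  ∏ k, if k ∈ I ∧ k < i then -1 else 1

/-- The sign is the parity of the number of elements of `I` below `i`, and this parity is additive
under symmetric difference. -/
lemma jwSign_symmDiff {n : ℕ} (i : Fin n) (I J : Finset (Fin n)) :
    jwSign i (symmDiff I J) = jwSign i I * jwSign i J := by
  rw [jwSign, jwSign, jwSign, ← Finset.prod_mul_distrib]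
  refine Finset.prod_congr rfl fun k _ => ?_
  by_cases h1 : k ∈ I <;> by_cases h2 : k ∈ J <;> by_cases h3 : k < i <;>
    simp [Finset.mem_symmDiff, h1, h2, h3]

lemma jwSign_singleton {n : ℕ} (i j : Fin n) :
    jwSign i {j} = if j < i then -1 else 1 := by
  rw [jwSign, Finset.prod_eq_single j]
  · simp
  · intro k _ hk
    simp [hk]
  · simp

lemma jwSign_mul_self {n : ℕ} (i : Fin n) (I : Finset (Fin n)) :
    jwSign i I * jwSign i I = 1 := by
  rw [← jwSign_symmDiff, symmDiff_self]
  simp [jwSign]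

/-- The Jordan–Wigner matrices: symmetric real matrices which satisfy the Clifford relations. -/
def jw {n : ℕ} (i : Fin n) : Matrix (Finset (Fin n)) (Finset (Fin n)) ℝ :=
  Matrix.of fun I J => if J = symmDiff I {i} then jwSign i I else 0

lemma jw_transpose {n : ℕ} (i : Fin n) : (jw i).transpose = jw i := by
  ext I J
  have h : I = symmDiff J {i} ↔ J = symmDiff I {i} := by
    constructor <;> rintro rfl <;> simp
  simp only [jw, Matrix.transpose_apply, Matrix.of_apply, h]
  split_ifs with hJ
  · rw [hJ, jwSign_symmDiff, jwSign_singleton]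
    simp
  · rfl

lemma jw_mul_apply {n : ℕ} (i j : Fin n) (I K : Finset (Fin n)) :
    (jw i * jw j) I K = if K = symmDiff (symmDiff I {i}) {j} then
      jwSign i I * (jwSign j I * jwSign j {i}) else 0 := by
  rw [Matrix.mul_apply, Finset.sum_eq_single (symmDiff I {i})]
  · simp [jw, jwSign_symmDiff]
  · intro J _ hJ
    simp [jw, hJ]
  · simp

lemma jw_mul_self {n : ℕ} (i : Fin n) : jw i * jw i = 1 := by
  ext I K
  rw [jw_mul_apply, jwSign_singleton, symmDiff_assoc, symmDiff_self, Finset.bot_eq_empty,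
    ← Finset.bot_eq_empty, symmDiff_bot]
  simp [jwSign_mul_self, Matrix.one_apply, eq_comm]

/-- Flipping `i` and `j` in either order leads to the same set. The signs differ because exactly one
of `j < i` and `i < j` holds. -/
lemma jw_anticomm {n : ℕ} {i j : Fin n} (h : i ≠ j) : jw i * jw j + jw j * jw i = 0 := by
  ext I K
  have hs : symmDiff (symmDiff I {i}) {j} = symmDiff (symmDiff I {j}) {i} := symmDiff_right_comm ..
  rw [Matrix.add_apply, jw_mul_apply, jw_mul_apply, hs, jwSign_singleton, jwSign_singleton]
  split_ifs with h1 h2 h3 h3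
  · exact absurd h2 (not_lt_of_gt h3)
  · simp only [Matrix.zero_apply]; ring
  · simp only [Matrix.zero_apply]; ring
  · exact absurd (le_antisymm (not_lt.mp h3) (not_lt.mp ‹_›)) (by tauto)
  · simp

/-- Symmetrisation of a quadratic expression in elements with prescribed anticommutators. -/
lemma sum_sum_smul_mul_eq {R A ι : Type*} [Field R] [CharZero R] [Ring A] [Algebra R A] [Fintype ι]
    [DecidableEq ι] (E : ι → A) (h1 : ∀ i, E i * E i = 1)
    (h2 : ∀ i j, i ≠ j → E i * E j + E j * E i = 0) (c : ι → ι → R) (hc : ∀ i j, c i j = c j i) :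
    ∑ i, ∑ j, c i j • (E i * E j) = (∑ i, c i i) • (1 : A) := by
  have h3 : (2 : R) • ∑ i, ∑ j, c i j • (E i * E j) =
      ∑ i, ∑ j, c i j • (E i * E j + E j * E i) := by
    simp only [smul_add, Finset.sum_add_distrib, two_smul]
    congr 1
    rw [Finset.sum_comm]
    exact Finset.sum_congr rfl fun i _ => Finset.sum_congr rfl fun j _ => by rw [hc]
  have h4 : ∑ i, ∑ j, c i j • (E i * E j + E j * E i) = (2 : R) • (∑ i, c i i) • (1 : A) := by
    rw [Finset.sum_smul, Finset.smul_sum]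
    refine Finset.sum_congr rfl fun i _ => ?_
    rw [Finset.sum_eq_single i]
    · rw [h1, ← two_smul R (1 : A), smul_comm]
    · intro j _ hj
      rw [h2 i j hj.symm, smul_zero]
    · simp
  have := h3.trans h4
  exact smul_right_injective A (two_ne_zero (α := R)) this

/-- The Jordan–Wigner representation of the Clifford algebra. -/
def jwRep (n : ℕ) : Cl n →ₐ[ℝ] Matrix (Finset (Fin n)) (Finset (Fin n)) ℝ :=
  CliffordAlgebra.lift (euclideanForm n)
    ⟨∑ i, (LinearMap.proj i : (Fin n → ℝ) →ₗ[ℝ] ℝ).smulRight (jw i), by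
      intro x
      simp only [LinearMap.sum_apply, LinearMap.smulRight_apply, LinearMap.proj_apply]
      rw [Finset.sum_mul_sum]
      simp only [smul_mul_smul_comm]
      rw [sum_sum_smul_mul_eq jw jw_mul_self (fun i j h => jw_anticomm h) (fun i j => x i * x j)
        (fun i j => mul_comm _ _), Algebra.algebraMap_eq_smul_one]
      simp [euclideanForm, QuadraticMap.weightedSumSquares_apply]⟩

lemma jwRep_ι {n : ℕ} (x : Fin n → ℝ) :
    jwRep n (CliffordAlgebra.ι _ x) = ∑ i, x i • jw i := by
  simp [jwRep]

/-- Both sides reverse products, and generators go to symmetric matrices. This makes the image of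
the spin group orthogonal. -/
lemma jwRep_reverse {n : ℕ} (x : Cl n) :
    jwRep n (CliffordAlgebra.reverse x) = (jwRep n x).transpose := by
  induction x using CliffordAlgebra.induction with
  | algebraMap r => simp [Matrix.algebraMap_eq_diagonal]
  | ι x => simp [jwRep_ι, Matrix.transpose_sum, jw_transpose]
  | mul a b ha hb => simp [ha, hb]
  | add a b ha hb => simp [ha, hb]

lemma finrank_Cl (n : ℕ) : Module.finrank ℝ (Cl n) = Fintype.card (Finset (Fin n)) := by
  rw [(CliffordAlgebra.equivExterior (euclideanForm n)).finrank_eq]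
  exact Module.finrank_eq_card_basis (Pi.basisFun ℝ (Fin n)).ExteriorAlgebra

/-- Row `∅` of the matrix already determines the element: up to sign, the product of the generators
indexed by `I` has the unit vector at `I` as its row `∅`, and the Clifford algebra has the same
dimension as the space of rows. -/
lemma jwRep_injective (n : ℕ) : Function.Injective (jwRep n) := by
  let f : Cl n →ₗ[ℝ] (Finset (Fin n) → ℝ) :=
    LinearMap.proj (R := ℝ) (φ := fun _ => Finset (Fin n) → ℝ) ∅ ∘ₗ (jwRep n).toLinearMap
  have hf : ∀ x J, f x J = jwRep n x ∅ J := fun _ _ => rfl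
  have hs : ∀ I, ∃ x, f x = Pi.single I 1 := by
    intro I
    induction I using Finset.induction_on with
    | empty =>
      refine ⟨1, funext fun J => ?_⟩
      rw [hf, map_one, Matrix.one_apply, Pi.single_apply]
      simp [eq_comm]
    | insert i I hi ih =>
      obtain ⟨x, hx⟩ := ih
      -- Right multiplication by the generator moves the unit vector at `I` to `insert i I` with
      -- sign `jwSign i I`; the scalar cancels that sign.
      refine ⟨jwSign i I • (x * CliffordAlgebra.ι _ (Pi.single i 1)), funext fun K => ?_⟩
      have h1 : ∀ J, jwRep n x ∅ J = (Pi.single I 1 : Finset (Fin n) → ℝ) J := fun J => by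
        rw [← hx, hf]
      have h2 : insert i I = symmDiff I {i} := by
        ext k
        by_cases hk : k = i <;> simp [Finset.mem_symmDiff, hk, hi]
      rw [map_smul, Pi.smul_apply, hf, map_mul, jwRep_ι, Matrix.mul_apply]
      simp only [h1, Pi.single_apply, ite_smul, one_smul, zero_smul, Finset.sum_ite_eq',
        Finset.mem_univ, if_true, ite_mul, one_mul, zero_mul, h2, smul_eq_mul]
      simp only [jw, Matrix.of_apply, mul_ite, jwSign_mul_self, mul_zero]
  have hsurj : Function.Surjective f := by
    rw [← LinearMap.range_eq_top, eq_top_iff, ← (Pi.basisFun ℝ (Finset (Fin n))).span_eq,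
      Submodule.span_le]
    rintro _ ⟨I, rfl⟩
    obtain ⟨x, hx⟩ := hs I
    exact ⟨x, by rw [hx, Pi.basisFun_apply]⟩
  have hinj : Function.Injective f :=
    (LinearMap.injective_iff_surjective_of_finrank_eq_finrank
      (by rw [finrank_Cl, Module.finrank_fintype_fun_eq_card])).mpr hsurj
  intro x y h
  exact hinj (funext fun J => by rw [hf, hf, h])

/-! ### The invariant functional -/

lemma jwRep_mem_unitaryGroup {n : ℕ} (g : Spin n) :
    jwRep n (g : Cl n) ∈ Matrix.unitaryGroup (Finset (Fin n)) ℝ := by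
  -- Elements of the spin group are even, so `involute` fixes them.
  have h : CliffordAlgebra.reverse (g : Cl n) = star (g : Cl n) := by
    rw [CliffordAlgebra.star_def, spinGroup.involute_eq g.2]
  rw [Matrix.mem_unitaryGroup_iff, Matrix.star_eq_conjTranspose,
    Matrix.conjTranspose_eq_transpose_of_trivial, ← jwRep_reverse, h, ← map_mul,
    spinGroup.mul_star_self_of_mem g.2, map_one]

/-- The Jordan–Wigner representation as an orthogonal representation of the spin group. -/
def jwGroup (n : ℕ) : Spin n →* Matrix.unitaryGroup (Finset (Fin n)) ℝ where
  toFun g := ⟨jwRep n (g : Cl n), jwRep_mem_unitaryGroup g⟩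
  map_one' := Subtype.ext (map_one (jwRep n))
  map_mul' g h := Subtype.ext (map_mul (jwRep n) (g : Cl n) (h : Cl n))

lemma compactSpace_unitaryGroup (ι : Type*) [Fintype ι] [DecidableEq ι] :
    CompactSpace (Matrix.unitaryGroup ι ℝ) := by
  refine isCompact_iff_compactSpace.mp ?_
  have hK : IsCompact (Set.univ.pi fun _ : ι => Set.univ.pi fun _ : ι =>
      Metric.closedBall (0 : ℝ) 1) :=
    isCompact_univ_pi fun _ => isCompact_univ_pi fun _ => isCompact_closedBall _ _
  refine hK.of_isClosed_subset ?_ fun A hA i _ j _ => ?_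
  · have : ((Matrix.unitaryGroup ι ℝ : Submonoid (Matrix ι ι ℝ)) : Set (Matrix ι ι ℝ)) =
        {A | A * star A = 1} := by
      ext A
      exact Matrix.mem_unitaryGroup_iff
    change IsClosed ((Matrix.unitaryGroup ι ℝ : Submonoid (Matrix ι ι ℝ)) : Set (Matrix ι ι ℝ))
    rw [this]
    exact isClosed_eq (by fun_prop) continuous_const
  · simpa using entry_norm_bound_of_unitary hA i j

/-- A compact group containing the spin group as a dense subgroup. -/
abbrev spinClosure (n : ℕ) : Subgroup (Matrix.unitaryGroup (Finset (Fin n)) ℝ) :=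
  (jwGroup n).range.topologicalClosure

instance compactSpace_spinClosure (n : ℕ) : CompactSpace (spinClosure n) :=
  haveI := compactSpace_unitaryGroup (Finset (Fin n))
  isCompact_iff_compactSpace.mp (Subgroup.isClosed_topologicalClosure _).isCompact

/-- The inclusion of the spin group in its closure. -/
def toClosure (n : ℕ) : Spin n →* spinClosure n :=
  (jwGroup n).codRestrict _ fun g => Subgroup.le_topologicalClosure _ ⟨g, rfl⟩

lemma toClosure_denseRange (n : ℕ) : DenseRange (toClosure n) := by
  rw [DenseRange, Subtype.dense_iff]
  intro x hx
  refine closure_mono ?_ hx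
  rintro _ ⟨g, rfl⟩
  exact ⟨toClosure n g, ⟨g, rfl⟩, rfl⟩

/-- Every polynomial function on the spin group extends continuously to its closure. -/
lemma exists_extension {n : ℕ} (a : Sn n) :
    ∃ f : C(spinClosure n, ℂ), ∀ g, f (toClosure n g) = a.1 g := by
  obtain ⟨a, ha⟩ := a
  induction ha using StarAlgebra.adjoin_induction with
  | mem x h =>
    obtain ⟨L, hL⟩ := h
    -- A left inverse of the faithful representation turns `L` into a linear function of the matrix
    -- entries, which is continuous on the closure.
    obtain ⟨l, hl⟩ := (jwRep n).toLinearMap.exists_leftInverse_of_injective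
      (LinearMap.ker_eq_bot.mpr (jwRep_injective n))
    have hc : Continuous (L ∘ₗ l) := LinearMap.continuous_of_finiteDimensional _
    refine ⟨⟨fun k => (L ∘ₗ l) (k : Matrix.unitaryGroup (Finset (Fin n)) ℝ).1, by fun_prop⟩,
      fun g => ?_⟩
    have := LinearMap.congr_fun hl (g : Cl n)
    change L (l (jwRep n (g : Cl n))) = x g
    rw [hL]
    exact congrArg L this
  | algebraMap r => exact ⟨algebraMap ℂ _ r, fun _ => rfl⟩
  | add x y hx hy h1 h2 =>
    obtain ⟨f1, h1⟩ := h1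
    obtain ⟨f2, h2⟩ := h2
    exact ⟨f1 + f2, fun g => congrArg₂ (· + ·) (h1 g) (h2 g)⟩
  | mul x y hx hy h1 h2 =>
    obtain ⟨f1, h1⟩ := h1
    obtain ⟨f2, h2⟩ := h2
    exact ⟨f1 * f2, fun g => congrArg₂ (· * ·) (h1 g) (h2 g)⟩
  | star x hx h =>
    obtain ⟨f, h⟩ := h
    exact ⟨star f, fun g => congrArg star (h g)⟩

/-- Left translation `a ↦ (h ↦ a (g * h))` of polynomial functions. -/
def leftTranslate {n : ℕ} (g : Spin n) : Sn n →ₗ[ℂ] Sn n :=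
  (TensorProduct.lid ℂ (Sn n)).toLinearMap ∘ₗ
    TensorProduct.map (evalAt g).toLinearMap LinearMap.id ∘ₗ (comul n).toLinearMap

lemma leftTranslate_apply {n : ℕ} (g h : Spin n) (a : Sn n) :
    (leftTranslate g a).1 h = a.1 (g * h) := by
  rw [← prodFun_comul, leftTranslate]
  simp only [LinearMap.comp_apply, AlgHom.toLinearMap_apply]
  induction comul n a using TensorProduct.induction_on with
  | zero => simp
  | tmul x y => rfl
  | add x y hx hy =>
    rw [map_add, map_add, map_add, Pi.add_apply, ← hx, ← hy]
    rfl

open MeasureTheory in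
/-- The existence of a normalised left invariant functional on the polynomial functions. -/
lemma exists_invariant_functional (n : ℕ) : ∃ h : Sn n →ₗ[ℂ] ℂ, h 1 = 1 ∧
    ∀ g a, h (leftTranslate g a) = h a := by
  let : MeasurableSpace (spinClosure n) := borel _
  have : BorelSpace (spinClosure n) := ⟨rfl⟩
  let μ : Measure (spinClosure n) := Measure.haar
  have hInt : ∀ f : C(spinClosure n, ℂ), Integrable f μ := fun f =>
    f.continuous.integrable_of_hasCompactSupport (HasCompactSupport.of_compactSpace f)
  -- Only the kernel of the Haar integral is formed, so that no linear choice of continuous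
  -- extensions is needed. A functional vanishing on `N` but not at 1 is then normalised.
  let N : Submodule ℂ (Sn n) :=
    { carrier := {a | ∃ f : C(spinClosure n, ℂ), (∀ g, f (toClosure n g) = a.1 g) ∧
        ∫ k, f k ∂μ = 0}
      zero_mem' := ⟨0, fun _ => rfl, by simp⟩
      add_mem' := by
        rintro a b ⟨f1, h1, h1'⟩ ⟨f2, h2, h2'⟩
        refine ⟨f1 + f2, fun g => congrArg₂ (· + ·) (h1 g) (h2 g), ?_⟩
        simp only [ContinuousMap.add_apply]
        rw [integral_add (hInt f1) (hInt f2), h1', h2', add_zero]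
      smul_mem' := by
        rintro c a ⟨f, h, h'⟩
        refine ⟨c • f, fun g => congrArg (c • ·) (h g), ?_⟩
        simp only [ContinuousMap.smul_apply]
        rw [integral_smul, h', smul_zero] }
  have h1 : (1 : Sn n) ∉ N := by
    rintro ⟨f, hf, hf'⟩
    -- By density the only continuous extension of 1 is 1, whose integral is the positive total
    -- mass.
    have : (f : spinClosure n → ℂ) = fun _ => 1 :=
      (toClosure_denseRange n).equalizer f.continuous continuous_const (funext hf)
    simp only [this, integral_const] at hf'
    have hpos : 0 < μ.real Set.univ :=
      ENNReal.toReal_pos (isOpen_univ.measure_pos μ Set.univ_nonempty).ne' (measure_ne_top _ _)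
    simp [hpos.ne'] at hf'
  obtain ⟨h, hh, hN⟩ := Submodule.exists_le_ker_of_notMem h1
  refine ⟨(h 1)⁻¹ • h, by simp [hh], fun g a => ?_⟩
  have h2 : leftTranslate g a - a ∈ N := by
    obtain ⟨f, hf⟩ := exists_extension a
    let f' : C(spinClosure n, ℂ) := f.comp ⟨fun k => toClosure n g * k, by fun_prop⟩
    refine ⟨f' - f, fun k => ?_, ?_⟩
    · change f (toClosure n g * toClosure n k) - f (toClosure n k) = _
      rw [← map_mul, hf, hf]
      exact congrArg (· - a.1 k) (leftTranslate_apply g k a).symm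
    · simp only [ContinuousMap.sub_apply]
      rw [integral_sub (hInt f') (hInt f)]
      exact sub_eq_zero.mpr (integral_mul_left_eq_self (μ := μ) f (toClosure n g))
  have h3 : h (leftTranslate g a - a) = 0 := hN h2
  rw [map_sub, sub_eq_zero] at h3
  simp [h3]

section

/-! ### Evaluation of tensors at points of the spin group -/

/-- The evaluation `m ⊗ a ↦ a g • m`. -/
def evalTensor {n : ℕ} {M : Type*} [AddCommGroup M] [Module ℂ M] (g : Spin n) :
    M ⊗[ℂ] Sn n →ₗ[ℂ] M :=
  (TensorProduct.rid ℂ M).toLinearMap ∘ₗ TensorProduct.map LinearMap.id (evalAt g).toLinearMap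

section evalTensor

variable {n : ℕ} {M N : Type*} [AddCommGroup M] [Module ℂ M] [AddCommGroup N] [Module ℂ N]

@[simp] lemma evalTensor_tmul (g : Spin n) (m : M) (a : Sn n) :
    evalTensor g (m ⊗ₜ a) = a.1 g • m := rfl

/-- In a basis of `M` the coefficients lie in `𝒮ₙ`, whose elements are genuine functions on the
group. -/
lemma evalTensor_ext {s t : M ⊗[ℂ] Sn n} (h : ∀ g, evalTensor g s = evalTensor g t) : s = t := by
  rw [← sub_eq_zero]
  replace h : ∀ g, evalTensor g (s - t) = 0 := fun g => by rw [map_sub, h, sub_self]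
  generalize s - t = s at h
  classical
  let b := Module.Basis.ofVectorSpace ℂ M
  obtain ⟨c, rfl⟩ := (TensorProduct.equivFinsuppOfBasisLeft (N := Sn n) b).symm.surjective s
  suffices c = 0 by rw [this, map_zero]
  rw [TensorProduct.equivFinsuppOfBasisLeft_symm_apply] at h
  ext i g
  have key : ∑ i ∈ c.support, (c i).1 g • b i = 0 := by
    simpa [Finsupp.sum] using h g
  have := linearIndependent_iff'.mp b.linearIndependent c.support (fun i => (c i).1 g) key i
  by_cases hi : i ∈ c.support
  · simpa using this hi
  · rw [Finsupp.notMem_support_iff.mp hi]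
    rfl

/-- The two parameters cover both translations (`c = 1`, `k` the translated point) and
multiplication by a fixed function (`k = g`, `c` its value at `g`). -/
lemma evalTensor_map (f : M →ₗ[ℂ] N) (φ : Sn n →ₗ[ℂ] Sn n) (g k : Spin n) (c : ℂ)
    (hφ : ∀ a, (φ a).1 g = c * a.1 k) (t : M ⊗[ℂ] Sn n) :
    evalTensor g (TensorProduct.map f φ t) = c • f (evalTensor k t) := by
  induction t using TensorProduct.induction_on with
  | zero => simp
  | tmul m a => simp [hφ, mul_smul]
  | add x y hx hy => simp only [map_add, hx, hy, smul_add]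

lemma evalTensor_map_id (f : M →ₗ[ℂ] N) (g : Spin n) (t : M ⊗[ℂ] Sn n) :
    evalTensor g (TensorProduct.map f LinearMap.id t) = f (evalTensor g t) := by
  rw [evalTensor_map f LinearMap.id g g 1 (by simp), one_smul]

lemma evalTensor_mul {A : Type*} [Ring A] [Algebra ℂ A] (g : Spin n) (s t : A ⊗[ℂ] Sn n) :
    evalTensor g (s * t) = evalTensor g s * evalTensor g t := by
  induction s using TensorProduct.induction_on with
  | zero => simp
  | add x y hx hy => simp only [add_mul, map_add, hx, hy]
  | tmul a c =>
    induction t using TensorProduct.induction_on with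
    | zero => simp
    | add x y hx hy => simp only [mul_add, map_add, hx, hy]
    | tmul b d =>
      rw [Algebra.TensorProduct.tmul_mul_tmul, evalTensor_tmul, evalTensor_tmul, evalTensor_tmul,
        smul_mul_smul_comm]
      rfl

lemma one_apply (g : Spin n) : (1 : Sn n).1 g = 1 := rfl

@[simp] lemma evalTensor_one {A : Type*} [Ring A] [Algebra ℂ A] (g : Spin n) :
    evalTensor g (1 : A ⊗[ℂ] Sn n) = 1 := by
  rw [Algebra.TensorProduct.one_def, evalTensor_tmul, one_apply, one_smul]

end evalTensor

/-! ### The orthogonality relations -/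

lemma polar_euclideanForm {n : ℕ} (x y : Fin n → ℝ) :
    QuadraticMap.polar (euclideanForm n) x y = 2 * ∑ k, x k * y k := by
  simp only [QuadraticMap.polar, euclideanForm, QuadraticMap.weightedSumSquares_apply,
    Pi.add_apply, ← Finset.sum_sub_distrib, Finset.mul_sum, one_smul]
  exact Finset.sum_congr rfl fun _ _ => by ring

/-- The vector representation is orthogonal. -/
lemma sum_u_mul_u {n : ℕ} (j k : Fin n) :
    ∑ i, u n j i * u n k i = if j = k then 1 else 0 := by
  refine Subtype.ext (funext fun g => ?_)
  choose x hx hx' using fun i => conj_ι g i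
  -- Conjugation by `g` preserves anticommutators of vectors, hence inner products: the columns of
  -- the matrix are orthonormal.
  have h1 : ∀ i l, ∑ m, x i m * x l m = if i = l then 1 else 0 := by
    intro i l
    have hg : ((g⁻¹ : Spin n) : Cl n) * (g : Cl n) = 1 := by
      rw [← Submonoid.coe_mul, inv_mul_cancel, Submonoid.coe_one]
    have hg' : (g : Cl n) * ((g⁻¹ : Spin n) : Cl n) = 1 := by
      rw [← Submonoid.coe_mul, mul_inv_cancel, Submonoid.coe_one]
    have hm : ∀ a b : Cl n, ((g : Cl n) * a * ((g⁻¹ : Spin n) : Cl n)) *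
        ((g : Cl n) * b * ((g⁻¹ : Spin n) : Cl n)) =
        (g : Cl n) * (a * b) * ((g⁻¹ : Spin n) : Cl n) := fun a b => by
      simp only [mul_assoc]
      rw [← mul_assoc ((g⁻¹ : Spin n) : Cl n) (g : Cl n), hg, one_mul]
    have h2 := CliffordAlgebra.ι_mul_ι_add_swap (Q := euclideanForm n) (x i) (x l)
    rw [← hx, ← hx, hm, hm, ← add_mul, ← mul_add, CliffordAlgebra.ι_mul_ι_add_swap,
      ← Algebra.commutes, mul_assoc, hg', mul_one, polar_euclideanForm,
      polar_euclideanForm] at h2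
    have h3 := (algebraMap ℝ (Cl n)).injective h2
    have h4 : ∑ m, (Pi.single i 1 : Fin n → ℝ) m * (Pi.single l 1 : Fin n → ℝ) m =
        if i = l then 1 else 0 := by
      simp [Pi.single_apply, eq_comm]
    linarith
  let R : Matrix (Fin n) (Fin n) ℝ := Matrix.of fun m i => x i m
  have hR : R.transpose * R = 1 := by
    ext i l
    simp [Matrix.mul_apply, R, h1, Matrix.one_apply]
  -- For a square matrix, orthonormal columns give orthonormal rows, which is the relation wanted.
  have hR2 : R * R.transpose = 1 := mul_eq_one_comm.mp hR
  have hR' := congrFun (congrFun hR2 j) k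
  simp only [Matrix.mul_apply, R, Matrix.transpose_apply, Matrix.of_apply, Matrix.one_apply] at hR'
  have h5 : ((∑ i, u n j i * u n k i : Sn n) : Spin n → ℂ) g =
      ((∑ i, x i j * x i k : ℝ) : ℂ) := by
    rw [AddSubmonoidClass.coe_finsetSum, Finset.sum_apply]
    push_cast
    exact Finset.sum_congr rfl fun i _ => congrArg₂ (· * ·) (hx' i j) (hx' i k)
  rw [h5, hR']
  split_ifs <;> simp

/-! ### The action of the spin group on the bundle -/

variable {n : ℕ} {V B : Type*} [Ring V] [Algebra ℂ V] [StarRing V] [StarModule ℂ V]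
  [Ring B] [Algebra ℂ B] [StarRing B] [StarModule ℂ B]

namespace SpinBundle

variable (P : SpinBundle n V B)

/-- The action of a point of the spin group on `B`. -/
def act (g : Spin n) : B →ₗ[ℂ] B := evalTensor g ∘ₗ P.F.toAlgHom.toLinearMap

lemma act_apply (g : Spin n) (b : B) : P.act g b = evalTensor g (P.F b) := rfl

lemma act_mul (g : Spin n) (b c : B) : P.act g (b * c) = P.act g b * P.act g c := by
  rw [act_apply, map_mul, evalTensor_mul, act_apply, act_apply]

lemma act_one (b : B) : P.act 1 b = b := P.counit_F b

/-- This is coassociativity of F evaluated at the pair `(g, k)`; `E` performs that evaluation. -/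
lemma act_act (g k : Spin n) (b : B) : P.act g (P.act k b) = P.act (g * k) b := by
  let E : B ⊗[ℂ] (Sn n ⊗[ℂ] Sn n) →ₗ[ℂ] B := (TensorProduct.rid ℂ B).toLinearMap ∘ₗ
    TensorProduct.map LinearMap.id (LinearMap.proj (R := ℂ) (φ := fun _ => ℂ) (g, k) ∘ₗ
      (prodFun n).toLinearMap)
  have hE : ∀ b a c, E (b ⊗ₜ (a ⊗ₜ c)) = (a.1 g * c.1 k) • b := fun _ _ _ => rfl
  have h1 : ∀ t, E (TensorProduct.map LinearMap.id (comul n).toLinearMap t) =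
      evalTensor (g * k) t := by
    intro t
    induction t using TensorProduct.induction_on with
    | zero => simp
    | tmul m a =>
      change prodFun n (comul n a) (g, k) • m = _
      rw [prodFun_comul, evalTensor_tmul]
    | add x y hx hy => simp only [map_add, hx, hy]
  have h2 : ∀ (s : B ⊗[ℂ] Sn n) a, E (TensorProduct.assoc ℂ B (Sn n) (Sn n) (s ⊗ₜ a)) =
      a.1 k • evalTensor g s := by
    intro s a
    induction s using TensorProduct.induction_on with
    | zero => simp
    | tmul m c =>
      rw [TensorProduct.assoc_tmul, hE, evalTensor_tmul, smul_smul, mul_comm]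
    | add x y hx hy => simp only [TensorProduct.add_tmul, map_add, hx, hy, smul_add]
  have h3 : ∀ t, E (TensorProduct.assoc ℂ B (Sn n) (Sn n)
      (TensorProduct.map P.F.toAlgHom.toLinearMap LinearMap.id t)) = P.act g (evalTensor k t) := by
    intro t
    induction t using TensorProduct.induction_on with
    | zero => simp
    | tmul m a => rw [TensorProduct.map_tmul, h2, evalTensor_tmul, map_smul]; rfl
    | add x y hx hy => simp only [map_add, hx, hy]
  rw [P.act_apply k, ← h3, P.coassoc, h1, act_apply]

lemma mem_range_i_iff (b : B) : (∃ f, P.i f = b) ↔ ∀ g, P.act g b = b := by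
  rw [P.mem_range_i]
  constructor
  · intro h g
    rw [act_apply, h, evalTensor_tmul, one_apply, one_smul]
  · intro h
    refine evalTensor_ext fun g => ?_
    rw [← act_apply, h, evalTensor_tmul, one_apply, one_smul]

/-! ### Freeness, averaging and factorisation through the coaction. -/

/-- The canonical map `q ⊗ b ↦ (q ⊗ 1) F(b)`. -/
def can : B ⊗[ℂ] B →ₗ[ℂ] B ⊗[ℂ] Sn n :=
  LinearMap.mul' ℂ (B ⊗[ℂ] Sn n) ∘ₗ TensorProduct.map
    (Algebra.TensorProduct.includeLeft : B →ₐ[ℂ] B ⊗[ℂ] Sn n).toLinearMap P.F.toAlgHom.toLinearMap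

lemma can_tmul (q b : B) : P.can (q ⊗ₜ b) = (q ⊗ₜ 1) * P.F b := rfl

/-- Freeness gives preimages of `1 ⊗ a`; choosing them on a vector space basis of `𝒮ₙ` makes the
choice linear. No equivariance is asked of `l`. -/
lemma exists_can_section : ∃ l : Sn n →ₗ[ℂ] B ⊗[ℂ] B, ∀ a, P.can (l a) = 1 ⊗ₜ a := by
  have h : ∀ a : Sn n, ∃ t, P.can t = 1 ⊗ₜ a := fun a => by
    obtain ⟨m, q, b, h⟩ := P.free a
    exact ⟨∑ k, q k ⊗ₜ b k, by rw [map_sum, ← h]; rfl⟩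
  choose t ht using h
  let b := Module.Basis.ofVectorSpace ℂ (Sn n)
  refine ⟨b.constr ℂ fun i => t (b i), fun a => ?_⟩
  have : P.can ∘ₗ b.constr ℂ (fun i => t (b i)) = TensorProduct.mk ℂ B (Sn n) 1 :=
    b.ext fun i => by simp [ht]
  exact LinearMap.congr_fun this a

set_option maxHeartbeats 1000000 in
/-- The average over the spin group. -/
lemma exists_average : ∃ H : B ⊗[ℂ] Sn n →ₗ[ℂ] B, (∀ b, H (b ⊗ₜ 1) = b) ∧
    (∀ t y, H (t * (y ⊗ₜ 1)) = H t * y) ∧ (∀ t y, H ((y ⊗ₜ 1) * t) = y * H t) ∧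
    ∀ b, ∃ f, P.i f = H (P.F b) := by
  obtain ⟨h, h1, hinv⟩ := exists_invariant_functional n
  obtain ⟨H, hH⟩ : ∃ H : B ⊗[ℂ] Sn n →ₗ[ℂ] B, ∀ b a, H (b ⊗ₜ a) = h a • b :=
    ⟨(TensorProduct.rid ℂ B).toLinearMap ∘ₗ TensorProduct.map LinearMap.id h, fun _ _ => rfl⟩
  refine ⟨H, fun b => by rw [hH, h1, one_smul], fun t y => ?_, fun t y => ?_, fun b => ?_⟩
  · have : H ∘ₗ LinearMap.mulRight ℂ (y ⊗ₜ 1) = LinearMap.mulRight ℂ y ∘ₗ H :=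
      TensorProduct.ext' fun m a => by
        simp only [LinearMap.comp_apply, LinearMap.mulRight_apply]
        rw [Algebra.TensorProduct.tmul_mul_tmul, mul_one, hH, hH, smul_mul_assoc]
    exact LinearMap.congr_fun this t
  · have : H ∘ₗ LinearMap.mulLeft ℂ (y ⊗ₜ 1) = LinearMap.mulLeft ℂ y ∘ₗ H :=
      TensorProduct.ext' fun m a => by
        simp only [LinearMap.comp_apply, LinearMap.mulLeft_apply]
        rw [Algebra.TensorProduct.tmul_mul_tmul, one_mul, hH, hH, mul_smul_comm]
    exact LinearMap.congr_fun this t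
  · rw [mem_range_i_iff]
    intro g
    -- Both sides have the value (gk)·b = g·(k·b) at `k`. Invariance of `h` removes the translation
    -- on the left, so g fixes the average.
    have e1 : TensorProduct.map LinearMap.id (leftTranslate g) (P.F b) =
        TensorProduct.map (P.act g) LinearMap.id (P.F b) := by
      refine evalTensor_ext fun k => ?_
      rw [evalTensor_map LinearMap.id (leftTranslate g) k (g * k) 1
        (fun a => by rw [leftTranslate_apply, one_mul]), evalTensor_map_id (P.act g), one_smul,
        LinearMap.id_apply, ← act_apply, ← act_apply, act_act]
    have e2 : ∀ t, H (TensorProduct.map LinearMap.id (leftTranslate g) t) = H t := by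
      intro t
      induction t using TensorProduct.induction_on with
      | zero => simp only [map_zero]
      | tmul m a => rw [TensorProduct.map_tmul, hH, hH, hinv]; rfl
      | add x y hx hy => simp only [map_add, hx, hy]
    have e3 : ∀ t, H (TensorProduct.map (P.act g) LinearMap.id t) = P.act g (H t) := by
      intro t
      induction t using TensorProduct.induction_on with
      | zero => simp only [map_zero]
      | tmul m a => rw [TensorProduct.map_tmul, hH, hH, map_smul]; rfl
      | add x y hx hy => simp only [map_add, hx, hy]
    rw [← e3, ← e1, e2]

/-- The map `w ⊗ x ⊗ y ↦ F(w x) (y ⊗ 1)`. -/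
def coactMul : B ⊗[ℂ] (B ⊗[ℂ] B) →ₗ[ℂ] B ⊗[ℂ] Sn n :=
  LinearMap.mul' ℂ (B ⊗[ℂ] Sn n) ∘ₗ
    TensorProduct.map (P.F.toAlgHom.toLinearMap ∘ₗ LinearMap.mul' ℂ B)
      (Algebra.TensorProduct.includeLeft : B →ₐ[ℂ] B ⊗[ℂ] Sn n).toLinearMap ∘ₗ
    (TensorProduct.assoc ℂ B B B).symm.toLinearMap

lemma coactMul_tmul (w x y : B) : P.coactMul (w ⊗ₜ (x ⊗ₜ y)) = P.F (w * x) * (y ⊗ₜ 1) := rfl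

/-- Write (g·(wx)) y = g·(w x (g⁻¹·y)); here x (g⁻¹·y) is the value of `P.can (x ⊗ₜ y)` at g⁻¹. -/
lemma evalTensor_coactMul (g : Spin n) (w : B) (t : B ⊗[ℂ] B) :
    evalTensor g (P.coactMul (w ⊗ₜ t)) = P.act g (w * evalTensor g⁻¹ (P.can t)) := by
  induction t using TensorProduct.induction_on with
  | zero => simp
  | tmul x y =>
    rw [coactMul_tmul, can_tmul, evalTensor_mul, evalTensor_mul, ← act_apply, ← act_apply,
      evalTensor_tmul, evalTensor_tmul, one_apply, one_smul, one_apply, one_smul, ← mul_assoc,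
      P.act_mul g (w * x), act_act, mul_inv_cancel, act_one]
  | add x y hx hy => simp only [TensorProduct.tmul_add, map_add, mul_add, hx, hy]

/-- Since l(a) is sent to 1 ⊗ a, the value at each g is g·(g⁻¹·b) = b. -/
lemma coactMul_section {l : Sn n →ₗ[ℂ] B ⊗[ℂ] B} (hl : ∀ a, P.can (l a) = 1 ⊗ₜ a) (b : B) :
    P.coactMul (TensorProduct.map LinearMap.id l (P.F b)) = b ⊗ₜ 1 := by
  have h : ∀ g t, evalTensor g (P.coactMul (TensorProduct.map LinearMap.id l t)) =
      P.act g (evalTensor g⁻¹ t) := by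
    intro g t
    induction t using TensorProduct.induction_on with
    | zero => simp only [map_zero]
    | tmul w a =>
      rw [TensorProduct.map_tmul, LinearMap.id_apply, evalTensor_coactMul, hl, evalTensor_tmul,
        evalTensor_tmul, mul_smul_comm, mul_one]
    | add x y hx hy => simp only [map_add, hx, hy]
  refine evalTensor_ext fun g => ?_
  rw [h, ← act_apply, act_act, mul_inv_cancel, act_one, evalTensor_tmul, one_apply, one_smul]

set_option maxHeartbeats 1000000 in
/-- A left `V`-linear map on `B` factors through the coaction. -/
theorem exists_factor {M : Type*} [Ring M] [Algebra ℂ M] (ι : B →ₐ[ℂ] M) (D : B →ₗ[ℂ] M)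
    (hD : ∀ f b, D (P.i f * b) = ι (P.i f) * D b) :
    ∃ ϱ : Sn n →ₗ[ℂ] M, ∀ b,
      LinearMap.mul' ℂ M (TensorProduct.map ι.toLinearMap ϱ (P.F b)) = D b := by
  obtain ⟨H, hH1, hHr, hHl, hHF⟩ := P.exists_average
  obtain ⟨l, hl⟩ := P.exists_can_section
  -- The factor is ϱ(a) = Σ ι(H((1 ⊗ a₁) F(x))) D(y), with a₁ ⊗ a₂ the coproduct of a and Σ x ⊗ y =
  -- l(a₂). By coassociativity Σ b₀ϱ(b₁) becomes Σ ι(H(F(b₀x))) D(y), with x ⊗ y from l(b₁). The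
  -- average lies in V and moves into D, leaving D(H(b ⊗ 1)) = D(b).
  obtain ⟨L, hL⟩ : ∃ L : (B ⊗[ℂ] Sn n) ⊗[ℂ] (B ⊗[ℂ] B) →ₗ[ℂ] M,
      ∀ s x y, L (s ⊗ₜ (x ⊗ₜ y)) = ι (H (s * P.F x)) * D y :=
    ⟨LinearMap.mul' ℂ M ∘ₗ
      TensorProduct.map (ι.toLinearMap ∘ₗ H ∘ₗ LinearMap.mul' ℂ (B ⊗[ℂ] Sn n) ∘ₗ
        TensorProduct.map LinearMap.id P.F.toAlgHom.toLinearMap) D ∘ₗ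
      (TensorProduct.assoc ℂ (B ⊗[ℂ] Sn n) B B).symm.toLinearMap, fun _ _ _ => rfl⟩
  obtain ⟨Φ, hΦ⟩ : ∃ Φ : Sn n ⊗[ℂ] Sn n →ₗ[ℂ] M, ∀ c a, Φ (c ⊗ₜ a) = L ((1 ⊗ₜ c) ⊗ₜ l a) :=
    ⟨L ∘ₗ TensorProduct.map
      (Algebra.TensorProduct.includeRight : Sn n →ₐ[ℂ] B ⊗[ℂ] Sn n).toLinearMap l, fun _ _ => rfl⟩
  have hL1 : ∀ w c t, ι w * L ((1 ⊗ₜ c) ⊗ₜ t) = L ((w ⊗ₜ c) ⊗ₜ t) := by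
    intro w c t
    have : LinearMap.mulLeft ℂ (ι w) ∘ₗ L ∘ₗ TensorProduct.mk ℂ (B ⊗[ℂ] Sn n) (B ⊗[ℂ] B) (1 ⊗ₜ c) =
        L ∘ₗ TensorProduct.mk ℂ (B ⊗[ℂ] Sn n) (B ⊗[ℂ] B) (w ⊗ₜ c) :=
      TensorProduct.ext' fun x y => by
        simp only [LinearMap.comp_apply, LinearMap.mulLeft_apply, TensorProduct.mk_apply]
        rw [hL, hL, ← mul_assoc, ← map_mul, ← hHl, ← mul_assoc,
          Algebra.TensorProduct.tmul_mul_tmul, mul_one, one_mul]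
    exact LinearMap.congr_fun this t
  have hL2 : ∀ w t, L (P.F w ⊗ₜ t) = D (H (P.coactMul (w ⊗ₜ t))) := by
    intro w t
    induction t using TensorProduct.induction_on with
    | zero => simp only [TensorProduct.tmul_zero, map_zero]
    | tmul x y =>
      -- The average of `w * x` comes from V, so left V-linearity carries it inside `D`.
      obtain ⟨f, hf⟩ := hHF (w * x)
      rw [hL, coactMul_tmul, hHr, ← map_mul, ← hf, hD]
    | add x y hx hy => simp only [TensorProduct.tmul_add, map_add, hx, hy]
  let Γ : (B ⊗[ℂ] Sn n) ⊗[ℂ] Sn n →ₗ[ℂ] M := LinearMap.mul' ℂ M ∘ₗ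
    TensorProduct.map ι.toLinearMap Φ ∘ₗ (TensorProduct.assoc ℂ B (Sn n) (Sn n)).toLinearMap
  have hΓ' : ∀ w c a, Γ ((w ⊗ₜ c) ⊗ₜ a) = ι w * Φ (c ⊗ₜ a) := fun _ _ _ => rfl
  have hΓ : ∀ s a, Γ (s ⊗ₜ a) = L (s ⊗ₜ l a) := by
    intro s a
    induction s using TensorProduct.induction_on with
    | zero => simp only [TensorProduct.zero_tmul, map_zero]
    | tmul w c => rw [hΓ', hΦ, hL1]
    | add x y hx hy => rw [TensorProduct.add_tmul, map_add, hx, hy, TensorProduct.add_tmul, map_add]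
  refine ⟨Φ ∘ₗ (comul n).toLinearMap, fun b => ?_⟩
  have s1 : TensorProduct.map ι.toLinearMap (Φ ∘ₗ (comul n).toLinearMap) (P.F b) =
      TensorProduct.map ι.toLinearMap Φ
        (TensorProduct.map LinearMap.id (comul n).toLinearMap (P.F b)) := by
    rw [← LinearMap.comp_apply, ← TensorProduct.map_comp, LinearMap.comp_id]
  have s2 : ∀ t, Γ (TensorProduct.map P.F.toAlgHom.toLinearMap LinearMap.id t) =
      D (H (P.coactMul (TensorProduct.map LinearMap.id l t))) := by
    intro t
    induction t using TensorProduct.induction_on with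
    | zero => simp only [map_zero]
    | tmul w a =>
      rw [TensorProduct.map_tmul, LinearMap.id_apply, hΓ, TensorProduct.map_tmul,
        LinearMap.id_apply, ← hL2]
      rfl
    | add x y hx hy => simp only [map_add, hx, hy]
  rw [s1, ← P.coassoc]
  change Γ (TensorProduct.map P.F.toAlgHom.toLinearMap LinearMap.id (P.F b)) = D b
  rw [s2, P.coactMul_section hl, hH1]

end SpinBundle

end

section

variable {n : ℕ} {V B : Type*} [Ring V] [Algebra ℂ V] [StarRing V] [StarModule ℂ V]
  [Ring B] [Algebra ℂ B] [StarRing B] [StarModule ℂ B]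

/-! ### Two-forms -/

lemma e_mul_swap (i j : Fin n) : (e i * e j : Ext n) = -(e j * e i) :=
  eq_neg_of_add_eq_zero_left (ExteriorAlgebra.ι_add_mul_swap _ _)

lemma sum_symm_tmul_e_mul_e {A : Type*} [Ring A] [Algebra ℂ A] (c : Fin n → Fin n → A)
    (hc : ∀ k l, c k l = c l k) : ∑ k, ∑ l, c k l ⊗ₜ[ℂ] (e k * e l : Ext n) = 0 := by
  have h : ∑ k, ∑ l, c k l ⊗ₜ[ℂ] (e k * e l : Ext n) =
      -∑ k, ∑ l, c k l ⊗ₜ[ℂ] (e k * e l : Ext n) := by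
    conv_lhs => rw [Finset.sum_comm]
    simp only [← Finset.sum_neg_distrib]
    refine Finset.sum_congr rfl fun k _ => Finset.sum_congr rfl fun l _ => ?_
    rw [hc, e_mul_swap, TensorProduct.tmul_neg]
  have h2 : (2 : ℂ) • ∑ k, ∑ l, c k l ⊗ₜ[ℂ] (e k * e l : Ext n) = 0 := by
    rw [two_smul]
    nth_rewrite 1 [h]
    exact neg_add_cancel _
  exact (smul_eq_zero.mp h2).resolve_left two_ne_zero

lemma comp2_e_mul_e (i j k l : Fin n) : comp2 n i j (e k * e l) =
    (if k = i then 1 else 0) * (if l = j then 1 else 0) -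
      (if l = i then 1 else 0) * (if k = j then 1 else 0) := by
  have h : ∀ (i k : Fin n), CliffordAlgebra.contractLeft
      (LinearMap.proj i : (Fin n → ℂ) →ₗ[ℂ] ℂ) (e k : Ext n) =
      algebraMap ℂ _ (if k = i then 1 else 0) := fun i k => by
    rw [e, ExteriorAlgebra.ι, CliffordAlgebra.contractLeft_ι]
    simp [Pi.single_apply, eq_comm]
  have h2 : CliffordAlgebra.contractLeft (LinearMap.proj i : (Fin n → ℂ) →ₗ[ℂ] ℂ)
      (e k * e l : Ext n) = (if k = i then (1 : ℂ) else 0) • e l -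
        (if l = i then (1 : ℂ) else 0) • e k := by
    have := CliffordAlgebra.contractLeft_ι_mul (Q := (0 : QuadraticForm ℂ (Fin n → ℂ)))
      (d := (LinearMap.proj i : (Fin n → ℂ) →ₗ[ℂ] ℂ)) (Pi.single k 1) (e l)
    rw [show (e k * e l : Ext n) = CliffordAlgebra.ι 0 (Pi.single k 1) * e l from rfl, this, h,
      ← Algebra.commutes, ← Algebra.smul_def]
    simp [Pi.single_apply, eq_comm, e, ExteriorAlgebra.ι]
  rw [comp2]
  simp only [LinearMap.comp_apply, h2, map_sub, map_smul, h, AlgHom.toLinearMap_apply,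
    ExteriorAlgebra.algebraMap_leftInverse _ _, smul_eq_mul]

/-- The component of a horizontal form along `eᵢ ∧ eⱼ`. -/
def horComp (A : Type*) [Ring A] [Algebra ℂ A] (i j : Fin n) : Hor n A →ₗ[ℂ] A :=
  (TensorProduct.rid ℂ A).toLinearMap ∘ₗ TensorProduct.map LinearMap.id (comp2 n i j)

lemma horComp_tmul {A : Type*} [Ring A] [Algebra ℂ A] (i j : Fin n) (b : A) (w : Ext n) :
    horComp A i j (b ⊗ₜ w) = comp2 n i j w • b := rfl

/-- The submodule of horizontal two-forms. -/
def twoForms (n : ℕ) (A : Type*) [Ring A] [Algebra ℂ A] : Submodule ℂ (Hor n A) :=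
  Submodule.span ℂ {w | ∃ (c : A) (k l : Fin n), w = c ⊗ₜ (e k * e l)}

lemma tmul_mem_twoForms {A : Type*} [Ring A] [Algebra ℂ A] (c : A) (k l : Fin n) :
    c ⊗ₜ (e k * e l) ∈ twoForms n A := Submodule.subset_span ⟨c, k, l, rfl⟩

lemma mul_mem_twoForms {A : Type*} [Ring A] [Algebra ℂ A] (q : A) {w : Hor n A}
    (hw : w ∈ twoForms n A) : (q ⊗ₜ 1) * w ∈ twoForms n A := by
  induction hw using Submodule.span_induction with
  | mem w h =>
    obtain ⟨c, k, l, rfl⟩ := h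
    rw [Algebra.TensorProduct.tmul_mul_tmul, one_mul]
    exact tmul_mem_twoForms _ _ _
  | zero => rw [mul_zero]; exact zero_mem _
  | add x y _ _ hx hy => rw [mul_add]; exact add_mem hx hy
  | smul c x _ hx => rw [mul_smul_comm]; exact Submodule.smul_mem _ _ hx

/-- Passing across two one-forms costs two signs. -/
lemma e_mul_twoForm {A : Type*} [Ring A] [Algebra ℂ A] (i : Fin n) {w : Hor n A}
    (hw : w ∈ twoForms n A) : (1 ⊗ₜ e i) * w = w * (1 ⊗ₜ e i) := by
  induction hw using Submodule.span_induction with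
  | mem w h =>
    obtain ⟨c, k, l, rfl⟩ := h
    rw [Algebra.TensorProduct.tmul_mul_tmul, Algebra.TensorProduct.tmul_mul_tmul, one_mul,
      mul_one, ← mul_assoc, e_mul_swap i k, neg_mul, mul_assoc, e_mul_swap i l, mul_neg, neg_neg,
      mul_assoc]
  | zero => rw [mul_zero, zero_mul]
  | add x y _ _ hx hy => rw [mul_add, add_mul, hx, hy]
  | smul c x _ hx => rw [mul_smul_comm, smul_mul_assoc, hx]

/-- The pairs (k, l) and (l, k) contribute equally, since both the component and the product change
sign; hence the factor 1/2. -/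
lemma twoForm_eq_sum {A : Type*} [Ring A] [Algebra ℂ A] {w : Hor n A} (hw : w ∈ twoForms n A) :
    w = (1 / 2 : ℂ) • ∑ i, ∑ j, horComp A i j w ⊗ₜ[ℂ] (e i * e j) := by
  induction hw using Submodule.span_induction with
  | mem w h =>
    obtain ⟨c, k, l, rfl⟩ := h
    have h1 : ∀ i j, horComp A i j (c ⊗ₜ (e k * e l)) ⊗ₜ[ℂ] (e i * e j : Ext n) =
        (if k = i then if l = j then c ⊗ₜ[ℂ] (e i * e j : Ext n) else 0 else 0) -
          (if l = i then if k = j then c ⊗ₜ[ℂ] (e i * e j : Ext n) else 0 else 0) := by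
      intro i j
      rw [horComp_tmul, comp2_e_mul_e, sub_smul, TensorProduct.sub_tmul]
      congr 1 <;> split_ifs <;> simp
    simp only [h1, Finset.sum_sub_distrib, Finset.sum_ite_irrel, Finset.sum_const_zero,
      Finset.sum_ite_eq, Finset.mem_univ, if_true]
    rw [e_mul_swap l k, TensorProduct.tmul_neg, sub_neg_eq_add, ← two_smul ℂ, smul_smul]
    norm_num
  | zero => simp
  | add x y _ _ hx hy =>
    conv_lhs => rw [hx, hy]
    simp only [map_add, TensorProduct.add_tmul, Finset.sum_add_distrib, smul_add]
  | smul c x _ hx =>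
    conv_lhs => rw [hx]
    simp only [map_smul, ← TensorProduct.smul_tmul', ← Finset.smul_sum]
    rw [smul_comm]

/-! ### The square of the covariant derivative -/

lemma nabla_tmul (X : Fin n → B →ₗ[ℂ] B) (b : B) (w : Ext n) :
    nabla X (b ⊗ₜ w) = ∑ k, X k b ⊗ₜ (e k * w) := by
  simp [nabla]

/-- The square of the covariant derivative on the elements of the bundle. -/
def nablaSq (X : Fin n → B →ₗ[ℂ] B) : B →ₗ[ℂ] Hor n B :=
  nabla X ∘ₗ nabla X ∘ₗ (Algebra.TensorProduct.includeLeft : B →ₐ[ℂ] Hor n B).toLinearMap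

lemma nablaSq_apply (X : Fin n → B →ₗ[ℂ] B) (b : B) :
    nablaSq X b = ∑ k, ∑ l, X k (X l b) ⊗ₜ (e k * e l) := by
  change nabla X (nabla X (b ⊗ₜ 1)) = _
  simp only [nabla_tmul, map_sum, mul_one]
  exact Finset.sum_comm

lemma nabla_nabla_tmul (X : Fin n → B →ₗ[ℂ] B) (b : B) (w : Ext n) :
    nabla X (nabla X (b ⊗ₜ w)) = nablaSq X b * (1 ⊗ₜ w) := by
  rw [nablaSq_apply]
  simp only [nabla_tmul, map_sum, Finset.sum_mul, Algebra.TensorProduct.tmul_mul_tmul, mul_one,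
    mul_assoc]
  exact Finset.sum_comm

lemma nablaSq_mem_twoForms (X : Fin n → B →ₗ[ℂ] B) (b : B) : nablaSq X b ∈ twoForms n B := by
  rw [nablaSq_apply]
  exact sum_mem fun k _ => sum_mem fun l _ => tmul_mem_twoForms _ _ _

lemma horComp_nablaSq (X : Fin n → B →ₗ[ℂ] B) (i j : Fin n) (b : B) :
    horComp B i j (nablaSq X b) = X i (X j b) - X j (X i b) := by
  rw [nablaSq_apply]
  simp only [map_sum, horComp_tmul, comp2_e_mul_e, sub_smul, Finset.sum_sub_distrib, ite_mul,
    one_mul, zero_mul, ite_smul, one_smul, zero_smul, Finset.sum_ite_irrel, Finset.sum_const_zero,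
    Finset.sum_ite_eq', Finset.mem_univ, if_true]

section

variable {P : SpinBundle n V B} {τ : FrameStructure P} (S : IntegrableSystem τ)

namespace IntegrableSystem

/-- The cross terms are symmetric in the two indices, so they cancel against the antisymmetric wedge
product. -/
lemma nablaSq_mul (b c : B) :
    nablaSq S.X (b * c) = nablaSq S.X b * (c ⊗ₜ 1) + (b ⊗ₜ 1) * nablaSq S.X c := by
  have h := sum_symm_tmul_e_mul_e (fun k l => S.X l b * S.X k c + S.X k b * S.X l c)
    (fun k l => add_comm _ _)
  rw [← add_zero (_ + _), ← h]
  simp only [nablaSq_apply, S.X_mul, map_add, TensorProduct.add_tmul, Finset.sum_mul,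
    Finset.mul_sum, Algebra.TensorProduct.tmul_mul_tmul, mul_one, one_mul, Finset.sum_add_distrib]
  abel

/-- Zero torsion makes the second derivatives of `f` symmetric. -/
lemma nablaSq_i (f : V) : nablaSq S.X (P.i f) = 0 := by
  rw [nablaSq_apply]
  simp only [S.X_i]
  exact sum_symm_tmul_e_mul_e (fun k l => S.X k (τ.del l f))
    (fun k l => sub_eq_zero.mp (S.torsion_free k l f))

lemma nablaSq_i_mul (f : V) (b : B) :
    nablaSq S.X (P.i f * b) = (P.i f ⊗ₜ 1) * nablaSq S.X b := by
  rw [nablaSq_mul, nablaSq_i, zero_mul, zero_add]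

/-- Read ∇³f once as ∇²(∇f) and once as ∇(∇²f) = 0. -/
lemma sum_nablaSq_del (f : V) : ∑ k, nablaSq S.X (τ.del k f) * (1 ⊗ₜ e k) = 0 := by
  have h : nabla S.X (P.i f ⊗ₜ 1) = ∑ k, τ.del k f ⊗ₜ e k := by
    rw [nabla_tmul]
    simp only [S.X_i, mul_one]
  have h2 : nabla S.X (nabla S.X (nabla S.X (P.i f ⊗ₜ 1))) = 0 := by
    change nabla S.X (nablaSq S.X (P.i f)) = 0
    rw [S.nablaSq_i, map_zero]
  rw [h] at h2
  simpa only [map_sum, nabla_nabla_tmul] using h2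

end IntegrableSystem

lemma FrameStructure.sum_u_del (τ : FrameStructure P) (k : Fin n) (f : V) :
    ∑ j, (1 ⊗ₜ u n k j) * P.F (τ.del j f) = τ.del k f ⊗ₜ 1 := by
  simp only [τ.F_del, Finset.mul_sum, Algebra.TensorProduct.tmul_mul_tmul, one_mul]
  rw [Finset.sum_comm]
  simp only [← TensorProduct.tmul_sum, sum_u_mul_u, TensorProduct.tmul_ite,
    Finset.sum_ite_eq, Finset.mem_univ, if_true]

/-- The frame `eᵢ = ∑ d f ⬝ c` in terms of differentials of elements of the base. -/
lemma FrameStructure.exists_dual (τ : FrameStructure P) (i : Fin n) :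
    ∃ (m : ℕ) (f : Fin m → V) (c : Fin m → B),
      (∀ j, ∑ α, τ.del j (f α) * c α = if i = j then 1 else 0) ∧
      ∀ k, ∑ α, (τ.del k (f α) ⊗ₜ 1) * P.F (c α) = 1 ⊗ₜ u n k i := by
  obtain ⟨m, b, v, h⟩ := τ.complete
  -- Taking adjoints in the completeness relation puts the hermitian derivations on the left.
  have h1 : ∀ j, ∑ α, τ.del j (star (v i α)) * star (b i α) = if i = j then 1 else 0 := by
    intro j
    have := congrArg star (h i j)
    rw [star_sum] at this
    simp only [star_mul, ← τ.del_star] at this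
    rw [this]
    split_ifs <;> simp
  refine ⟨m, fun α => star (v i α), fun α => star (b i α), h1, fun k => ?_⟩
  -- Orthogonality of u turns ∂ₖf ⊗ 1 into Σⱼ (1 ⊗ u_{kj}) F(∂ⱼf). By multiplicativity of F the
  -- completeness relation then leaves only j = i.
  simp only [← τ.sum_u_del, Finset.sum_mul]
  rw [Finset.sum_comm]
  simp only [mul_assoc, ← map_mul, ← Finset.mul_sum, ← map_sum, h1]
  rw [Finset.sum_eq_single i]
  · simp
  · intro j _ hj
    simp [hj.symm]
  · simp

/-! ### Existence and uniqueness of the curvature -/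

/-- The map `b ⊗ a ↦ b ϱ(a)`. -/
def convolve (ϱ : Sn n →ₗ[ℂ] Hor n B) : B ⊗[ℂ] Sn n →ₗ[ℂ] Hor n B :=
  LinearMap.mul' ℂ (Hor n B) ∘ₗ TensorProduct.map
    (Algebra.TensorProduct.includeLeft : B →ₐ[ℂ] Hor n B).toLinearMap ϱ

lemma convolve_tmul (ϱ : Sn n →ₗ[ℂ] Hor n B) (b : B) (a : Sn n) :
    convolve ϱ (b ⊗ₜ a) = (b ⊗ₜ 1) * ϱ a := rfl

lemma convolve_mul_left (ϱ : Sn n →ₗ[ℂ] Hor n B) (q : B) (v : Sn n) (t : B ⊗[ℂ] Sn n) :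
    convolve ϱ ((q ⊗ₜ v) * t) = (q ⊗ₜ 1) * convolve (ϱ ∘ₗ LinearMap.mulLeft ℂ v) t := by
  have : convolve ϱ ∘ₗ LinearMap.mulLeft ℂ (q ⊗ₜ v) =
      LinearMap.mulLeft ℂ (q ⊗ₜ 1) ∘ₗ convolve (ϱ ∘ₗ LinearMap.mulLeft ℂ v) :=
    TensorProduct.ext' fun b a => by
      simp only [LinearMap.comp_apply, LinearMap.mulLeft_apply, convolve_tmul,
        Algebra.TensorProduct.tmul_mul_tmul]
      rw [← mul_assoc, Algebra.TensorProduct.tmul_mul_tmul, mul_one]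
  exact LinearMap.congr_fun this t

lemma convolve_add (ϱ ϱ' : Sn n →ₗ[ℂ] Hor n B) (t : B ⊗[ℂ] Sn n) :
    convolve (ϱ + ϱ') t = convolve ϱ t + convolve ϱ' t := by
  have : convolve (ϱ + ϱ') = convolve ϱ + convolve ϱ' := TensorProduct.ext' fun b a => by
    simp only [LinearMap.add_apply, convolve_tmul, mul_add]
  exact LinearMap.congr_fun this t

lemma convolve_mul_right (ϱ : Sn n →ₗ[ℂ] Hor n B) (w : Hor n B) (t : B ⊗[ℂ] Sn n) :
    convolve (LinearMap.mulRight ℂ w ∘ₗ ϱ) t = convolve ϱ t * w := by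
  have : convolve (LinearMap.mulRight ℂ w ∘ₗ ϱ) = LinearMap.mulRight ℂ w ∘ₗ convolve ϱ :=
    TensorProduct.ext' fun b a => by
      simp only [LinearMap.comp_apply, LinearMap.mulRight_apply, convolve_tmul, mul_assoc]
  exact LinearMap.congr_fun this t

/-- `ϱ` can be recovered from the map `b ↦ ∑ b₀ ϱ(b₁)`. -/
lemma exists_apply_eq_sum (P : SpinBundle n V B) (a : Sn n) : ∃ (m : ℕ) (q b : Fin m → B),
    ∀ ϱ : Sn n →ₗ[ℂ] Hor n B, ϱ a = ∑ k, (q k ⊗ₜ 1) * convolve ϱ (P.F (b k)) := by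
  obtain ⟨m, q, b, h⟩ := P.free a
  refine ⟨m, q, b, fun ϱ => ?_⟩
  have h1 : convolve ϱ (1 ⊗ₜ a) = ϱ a := by
    rw [convolve_tmul, ← Algebra.TensorProduct.one_def, one_mul]
  have h2 : LinearMap.mulLeft ℂ (1 : Sn n) = LinearMap.id := LinearMap.mulLeft_one ..
  rw [← h1, ← h, map_sum]
  simp only [convolve_mul_left, h2, LinearMap.comp_id]

lemma eq_of_convolve_eq (P : SpinBundle n V B) {ϱ ϱ' : Sn n →ₗ[ℂ] Hor n B}
    (h : ∀ b, convolve ϱ (P.F b) = convolve ϱ' (P.F b)) : ϱ = ϱ' := by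
  refine LinearMap.ext fun a => ?_
  obtain ⟨m, q, b, ha⟩ := exists_apply_eq_sum P a
  rw [ha, ha]
  simp only [h]

lemma mem_twoForms_of_convolve (P : SpinBundle n V B) {ϱ : Sn n →ₗ[ℂ] Hor n B}
    (h : ∀ b, convolve ϱ (P.F b) ∈ twoForms n B) (a : Sn n) : ϱ a ∈ twoForms n B := by
  obtain ⟨m, q, b, ha⟩ := exists_apply_eq_sum P a
  rw [ha]
  exact sum_mem fun k _ => mul_mem_twoForms _ (h _)

end

end

/-! ### The first Bianchi identity and the curvature on all horizontal forms. -/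

section

variable {n : ℕ} {V B : Type*} [Ring V] [Algebra ℂ V] [StarRing V] [StarModule ℂ V]
  [Ring B] [Algebra ℂ B] [StarRing B] [StarModule ℂ B]
  {P : SpinBundle n V B} {τ : FrameStructure P} (S : IntegrableSystem τ)

/-- Write b eᵢ = Σ ∂ₖ(f) c b eₖ and apply the Leibniz rule to ∂ₖ(f)·(c b). The terms containing
∇²(∂ₖf) add up to zero by `sum_nablaSq_del`. -/
lemma IntegrableSystem.nablaSq_mul_e (i : Fin n) {m : ℕ} (f : Fin m → V) (c : Fin m → B)
    (h : ∀ j, ∑ α, τ.del j (f α) * c α = if i = j then 1 else 0) (b : B) :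
    nablaSq S.X b * (1 ⊗ₜ e i) =
      ∑ k, ∑ α, (τ.del k (f α) ⊗ₜ 1) * nablaSq S.X (c α * b) * (1 ⊗ₜ e k) := by
  have h1 : ∀ k α, (τ.del k (f α) ⊗ₜ 1) * nablaSq S.X (c α * b) * (1 ⊗ₜ e k) =
      nablaSq S.X (τ.del k (f α) * c α * b) * (1 ⊗ₜ e k) -
        nablaSq S.X (τ.del k (f α)) * (1 ⊗ₜ e k) * ((c α * b) ⊗ₜ 1) := by
    intro k α
    have hc : ((c α * b) ⊗ₜ[ℂ] (1 : Ext n)) * (1 ⊗ₜ e k) = (1 ⊗ₜ e k) * ((c α * b) ⊗ₜ 1) := by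
      simp only [Algebra.TensorProduct.tmul_mul_tmul, mul_one, one_mul]
    rw [mul_assoc (τ.del k (f α)), S.nablaSq_mul (τ.del k (f α)), add_mul, mul_assoc (nablaSq _ _), hc,
      ← mul_assoc (nablaSq _ _), add_sub_cancel_left]
  have h2 : ∑ k, ∑ α, nablaSq S.X (τ.del k (f α)) * (1 ⊗ₜ e k) * ((c α * b) ⊗ₜ[ℂ] (1 : Ext n)) =
      0 := by
    rw [Finset.sum_comm]
    refine Finset.sum_eq_zero fun α _ => ?_
    rw [← Finset.sum_mul, S.sum_nablaSq_del, zero_mul]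
  simp only [h1, Finset.sum_sub_distrib, h2, sub_zero]
  simp only [← Finset.sum_mul, ← map_sum, h]
  rw [Finset.sum_eq_single i]
  · simp
  · intro j _ hj
    simp [hj.symm]
  · simp

/-- The first Bianchi identity. -/
lemma IntegrableSystem.bianchi {ϱ : Sn n →ₗ[ℂ] Hor n B}
    (h : ∀ b, convolve ϱ (P.F b) = nablaSq S.X b) (i : Fin n) (a : Sn n) :
    ∑ k, ϱ (u n k i * a) * (1 ⊗ₜ e k) = ϱ a * (1 ⊗ₜ e i) := by
  obtain ⟨m, f, c, h1, h2⟩ := τ.exists_dual i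
  have h3 : ∑ k, LinearMap.mulRight ℂ (1 ⊗ₜ[ℂ] e k) ∘ₗ ϱ ∘ₗ LinearMap.mulLeft ℂ (u n k i) =
      LinearMap.mulRight ℂ (1 ⊗ₜ[ℂ] e i) ∘ₗ ϱ := by
    refine eq_of_convolve_eq P fun b => ?_
    have h4 : ∀ (s : Finset (Fin n)) (r : Fin n → Sn n →ₗ[ℂ] Hor n B) t,
        convolve (∑ k ∈ s, r k) t = ∑ k ∈ s, convolve (r k) t := by
      intro s r t
      classical
      induction s using Finset.induction_on with
      | empty =>
        have := convolve_add 0 (0 : Sn n →ₗ[ℂ] Hor n B) t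
        rwa [add_zero, left_eq_add] at this
      | insert k s hk ih => rw [Finset.sum_insert hk, Finset.sum_insert hk, convolve_add, ih]
    rw [h4, convolve_mul_right, h, S.nablaSq_mul_e i f c h1]
    refine Finset.sum_congr rfl fun k _ => ?_
    -- By the choice of `f` and `c`, (1 ⊗ u_{ki}) F(b) = Σ (∂ₖf ⊗ 1) F(c b), so its convolution with
    -- ϱ is Σ ∂ₖ(f) ∇²(c b).
    have h5 := convolve_mul_left ϱ 1 (u n k i) (P.F b)
    rw [← Algebra.TensorProduct.one_def, one_mul] at h5
    rw [convolve_mul_right, ← h5, ← h2, ← Finset.sum_mul]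
    congr 1
    have h6 : LinearMap.mulLeft ℂ (1 : Sn n) = LinearMap.id := LinearMap.mulLeft_one ..
    rw [Finset.sum_mul, map_sum]
    refine Finset.sum_congr rfl fun α _ => ?_
    rw [mul_assoc, ← map_mul, convolve_mul_left, h6, LinearMap.comp_id, h]
  have h7 := LinearMap.congr_fun h3 a
  simpa only [LinearMap.sum_apply, LinearMap.comp_apply, LinearMap.mulRight_apply,
    LinearMap.mulLeft_apply] using h7

/-- The map `φ ⊗ a ↦ φ ϱ(a)`. -/
def horConvolve (ϱ : Sn n →ₗ[ℂ] Hor n B) : Hor n B ⊗[ℂ] Sn n →ₗ[ℂ] Hor n B :=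
  LinearMap.mul' ℂ (Hor n B) ∘ₗ TensorProduct.map LinearMap.id ϱ

lemma horConvolve_tmul (ϱ : Sn n →ₗ[ℂ] Hor n B) (w : Hor n B) (a : Sn n) :
    horConvolve ϱ (w ⊗ₜ a) = w * ϱ a := rfl

lemma horConvolve_mul_left (ϱ : Sn n →ₗ[ℂ] Hor n B) (w : Hor n B) (a : Sn n)
    (t : Hor n B ⊗[ℂ] Sn n) :
    horConvolve ϱ ((w ⊗ₜ a) * t) = w * horConvolve ϱ ((1 ⊗ₜ a) * t) := by
  have : horConvolve ϱ ∘ₗ LinearMap.mulLeft ℂ (w ⊗ₜ a) =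
      LinearMap.mulLeft ℂ w ∘ₗ horConvolve ϱ ∘ₗ LinearMap.mulLeft ℂ (1 ⊗ₜ a) :=
    TensorProduct.ext' fun b c => by
      simp only [LinearMap.comp_apply, LinearMap.mulLeft_apply,
        Algebra.TensorProduct.tmul_mul_tmul, horConvolve_tmul, one_mul, mul_assoc]
  exact LinearMap.congr_fun this t

/-- The coaction on forms, with values in `hor ⊗ 𝒮ₙ`. -/
def extCoaction (n : ℕ) (B : Type*) [Ring B] [Algebra ℂ B] : Ext n →ₐ[ℂ] Hor n B ⊗[ℂ] Sn n :=
  (Algebra.TensorProduct.map (Algebra.TensorProduct.includeRight : Ext n →ₐ[ℂ] Hor n B)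
    (AlgHom.id ℂ (Sn n))).comp (uExt n)

lemma extCoaction_e (i : Fin n) :
    extCoaction n B (e i) = ∑ j, (1 ⊗ₜ e j) ⊗ₜ u n j i := by
  have : uExt n (e i) = ∑ j, e j ⊗ₜ u n j i := by
    rw [uExt, e, ExteriorAlgebra.lift_ι_apply, uVec, ← Pi.basisFun_apply, Module.Basis.constr_basis]
  rw [extCoaction, AlgHom.comp_apply, this, map_sum]
  rfl

lemma horCoaction_tmul (F : B →ₗ[ℂ] B ⊗[ℂ] Sn n) (b : B) (w : Ext n) :
    horCoaction F (b ⊗ₜ w) = TensorProduct.map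
      (Algebra.TensorProduct.includeLeft : B →ₐ[ℂ] Hor n B).toLinearMap LinearMap.id (F b) *
      extCoaction n B w := rfl

-- For one-forms this is the Bianchi identity `hb`, once eⱼ is moved past ϱ. It passes to products
-- because `a` is arbitrary: the coefficients produced by one factor are absorbed into the argument
-- of ϱ for the other.
set_option maxHeartbeats 1000000 in
lemma horConvolve_mul_extCoaction {ϱ : Sn n →ₗ[ℂ] Hor n B}
    (h2 : ∀ a, ϱ a ∈ twoForms n B)
    (hb : ∀ i a, ∑ k, ϱ (u n k i * a) * (1 ⊗ₜ e k) = ϱ a * (1 ⊗ₜ e i)) (w : Ext n) (a : Sn n) :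
    horConvolve ϱ ((1 ⊗ₜ a) * extCoaction n B w) = ϱ a * (1 ⊗ₜ w) := by
  induction w using ExteriorAlgebra.induction generalizing a with
  | algebraMap r =>
    rw [AlgHom.commutes, ← Algebra.commutes, ← Algebra.smul_def, map_smul, horConvolve_tmul,
      Algebra.algebraMap_eq_smul_one, TensorProduct.tmul_smul, ← Algebra.TensorProduct.one_def,
      one_mul, mul_smul_comm, mul_one]
  | ι x =>
    have hx : ExteriorAlgebra.ι ℂ x = ∑ i, x i • (e i : Ext n) := by
      conv_lhs => rw [← (Pi.basisFun ℂ (Fin n)).sum_repr x, map_sum]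
      simp [e]
    rw [hx, map_sum, Finset.mul_sum, map_sum, TensorProduct.tmul_sum, Finset.mul_sum]
    refine Finset.sum_congr rfl fun i _ => ?_
    rw [map_smul, mul_smul_comm, map_smul, TensorProduct.tmul_smul, mul_smul_comm, ← hb,
      extCoaction_e, Finset.mul_sum, map_sum]
    congr 1
    refine Finset.sum_congr rfl fun j _ => ?_
    rw [Algebra.TensorProduct.tmul_mul_tmul, one_mul, horConvolve_tmul, e_mul_twoForm _ (h2 _),
      mul_comm a]
  | mul x y hx hy =>
    have h3 : ∀ t, horConvolve ϱ ((1 ⊗ₜ a) * t * extCoaction n B y) =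
        horConvolve ϱ ((1 ⊗ₜ a) * t) * (1 ⊗ₜ y) := by
      intro t
      have : horConvolve ϱ ∘ₗ LinearMap.mulRight ℂ (extCoaction n B y) ∘ₗ
          LinearMap.mulLeft ℂ (1 ⊗ₜ a) = LinearMap.mulRight ℂ (1 ⊗ₜ y) ∘ₗ horConvolve ϱ ∘ₗ
          LinearMap.mulLeft ℂ (1 ⊗ₜ a) := TensorProduct.ext' fun b c => by
        simp only [LinearMap.comp_apply, LinearMap.mulLeft_apply, LinearMap.mulRight_apply,
          Algebra.TensorProduct.tmul_mul_tmul, one_mul]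
        rw [horConvolve_mul_left, hy, horConvolve_tmul, mul_assoc]
      exact LinearMap.congr_fun this t
    rw [map_mul (extCoaction n B), ← mul_assoc, h3, hx, mul_assoc, Algebra.TensorProduct.tmul_mul_tmul, one_mul]
  | add x y hx hy => rw [map_add, mul_add, map_add, hx, hy, TensorProduct.tmul_add, mul_add]

lemma horConvolve_horCoaction {ϱ : Sn n →ₗ[ℂ] Hor n B} {F : B →ₗ[ℂ] B ⊗[ℂ] Sn n}
    {w : Ext n} (h : ∀ a, horConvolve ϱ ((1 ⊗ₜ a) * extCoaction n B w) = ϱ a * (1 ⊗ₜ w)) (b : B) :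
    horConvolve ϱ (horCoaction F (b ⊗ₜ w)) = convolve ϱ (F b) * (1 ⊗ₜ w) := by
  rw [horCoaction_tmul]
  generalize F b = t
  have : horConvolve ϱ ∘ₗ LinearMap.mulRight ℂ (extCoaction n B w) ∘ₗ TensorProduct.map
      (Algebra.TensorProduct.includeLeft : B →ₐ[ℂ] Hor n B).toLinearMap LinearMap.id =
      LinearMap.mulRight ℂ (1 ⊗ₜ w) ∘ₗ convolve ϱ := TensorProduct.ext' fun b a => by
    simp only [LinearMap.comp_apply, LinearMap.mulRight_apply, TensorProduct.map_tmul,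
      convolve_tmul, LinearMap.id_apply, AlgHom.toLinearMap_apply]
    rw [horConvolve_mul_left, h, mul_assoc]
    rfl
  exact LinearMap.congr_fun this t

lemma IsCurvature.convolve_F {X : Fin n → B →ₗ[ℂ] B} {ϱ : Sn n →ₗ[ℂ] Hor n B}
    (h : IsCurvature P X ϱ) (b : B) : convolve ϱ (P.F b) = -nablaSq X b := by
  have h1 : nablaSq X b = -horConvolve ϱ (horCoaction P.F.toAlgHom.toLinearMap (b ⊗ₜ 1)) :=
    h (b ⊗ₜ 1)
  rw [horConvolve_horCoaction (fun a => by
    rw [map_one, mul_one, horConvolve_tmul, ← Algebra.TensorProduct.one_def, one_mul, mul_one]),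
    ← Algebra.TensorProduct.one_def, mul_one] at h1
  rw [h1, neg_neg]
  rfl

lemma IsCurvature.mem_twoForms {X : Fin n → B →ₗ[ℂ] B} {ϱ : Sn n →ₗ[ℂ] Hor n B}
    (h : IsCurvature P X ϱ) (a : Sn n) : ϱ a ∈ twoForms n B :=
  mem_twoForms_of_convolve P
    (fun b => by rw [h.convolve_F]; exact neg_mem (nablaSq_mem_twoForms X b)) a

theorem IntegrableSystem.existsUnique_curvature :
    ∃! ϱ : Sn n →ₗ[ℂ] Hor n B, IsCurvature P S.X ϱ := by
  obtain ⟨r, hr⟩ := P.exists_factor (Algebra.TensorProduct.includeLeft : B →ₐ[ℂ] Hor n B)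
    (nablaSq S.X) S.nablaSq_i_mul
  replace hr : ∀ b, convolve r (P.F b) = nablaSq S.X b := hr
  have h2 : ∀ a, r a ∈ twoForms n B :=
    mem_twoForms_of_convolve P fun b => by rw [hr]; exact nablaSq_mem_twoForms S.X b
  -- The minus sign in the definition of the curvature is absorbed here.
  refine ⟨-r, ?_, fun r' h' => eq_of_convolve_eq P fun b => ?_⟩
  · have h3 : nabla S.X ∘ₗ nabla S.X =
        horConvolve r ∘ₗ horCoaction P.F.toAlgHom.toLinearMap := TensorProduct.ext' fun b w => by
      simp only [LinearMap.comp_apply]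
      rw [horConvolve_horCoaction (horConvolve_mul_extCoaction h2 (S.bianchi hr) w),
        nabla_nabla_tmul, ← hr]
      rfl
    intro φ
    refine (LinearMap.congr_fun h3 φ).trans ?_
    rw [LinearMap.comp_apply, horConvolve, LinearMap.comp_apply]
    generalize horCoaction P.F.toAlgHom.toLinearMap φ = t
    have h4 : LinearMap.mul' ℂ (Hor n B) ∘ₗ TensorProduct.map LinearMap.id r =
        -(LinearMap.mul' ℂ (Hor n B) ∘ₗ TensorProduct.map LinearMap.id (-r)) :=
      TensorProduct.ext' fun x a => by simp
    exact LinearMap.congr_fun h4 t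
  · have h5 : convolve r (P.F b) + convolve (-r) (P.F b) = 0 := by
      rw [← convolve_add, add_neg_cancel]
      have := convolve_add 0 (0 : Sn n →ₗ[ℂ] Hor n B) (P.F b)
      rwa [add_zero, left_eq_add] at this
    rw [h'.convolve_F, eq_neg_of_add_eq_zero_right h5, hr]

end

section

/-! ### The codifferential in low degrees -/

lemma extBasis_empty (n : ℕ) : extBasis n ∅ = 1 := by
  have := ExteriorAlgebra.basis_apply_ofCard (Pi.basisFun ℂ (Fin n)) (s := ∅) (n := 0) rfl
  rw [extBasis, this, ExteriorAlgebra.ιMulti_family, ExteriorAlgebra.ιMulti_zero_apply]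

lemma extBasis_singleton {n : ℕ} (k : Fin n) : extBasis n {k} = e k := by
  have := ExteriorAlgebra.basis_apply_ofCard (Pi.basisFun ℂ (Fin n)) (s := {k}) (n := 1) rfl
  rw [extBasis, this, ExteriorAlgebra.ιMulti_family, ExteriorAlgebra.ιMulti_apply]
  have hk : ∀ s : Set.powersetCard (Fin n) 1, s.val = {k} →
      Set.powersetCard.ofFinEmbEquiv.symm s 0 = k := by
    intro s hs
    exact Finset.mem_singleton.mp (hs.le (Finset.orderEmbOfFin_mem s.val s.prop 0))
  have hk' := hk (Set.powersetCard.ofCard (rfl : ({k} : Finset (Fin n)).card = 1)) rfl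
  simp [e, hk']

lemma e_mul_extBasis {n : ℕ} {k : Fin n} {I : Finset (Fin n)} (h : k ∈ I) :
    e k * extBasis n I = 0 := by
  rw [← extBasis_singleton]
  exact ExteriorAlgebra.basis_mul_of_not_disjoint (Pi.basisFun ℂ (Fin n))
    (⟨{k}, rfl⟩ : Set.powersetCard (Fin n) _) (⟨I, rfl⟩ : Set.powersetCard (Fin n) _)
    (by simpa using h)

lemma hodge_one (n : ℕ) : hodge n 1 = extBasis n Finset.univ := by
  have := extBasis_mul_hodge (n := n) ∅
  rwa [extBasis_empty, one_mul] at this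

lemma hodge_univ (n : ℕ) : hodge n (extBasis n Finset.univ) = 1 := by
  rw [hodge, Module.Basis.constr_basis, Finset.compl_univ, extBasis_empty, mul_one,
    Module.Basis.repr_self, Finsupp.single_eq_same, one_smul]

lemma e_mul_hodge_e {n : ℕ} (l k : Fin n) :
    e l * hodge n (e k) = if l = k then extBasis n Finset.univ else 0 := by
  split_ifs with h
  · subst h
    rw [← extBasis_singleton, extBasis_mul_hodge]
  · rw [← extBasis_singleton k, hodge, Module.Basis.constr_basis, mul_smul_comm,
      e_mul_extBasis (by simpa using h), smul_zero]

section

variable {n : ℕ} {B : Type*} [Ring B] [Algebra ℂ B] (X : Fin n → B →ₗ[ℂ] B)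

/-- The Hodge operator sends functions to top forms, on which ∇ vanishes. -/
lemma nablaDagger_zero (b : B) : nablaDagger X (b ⊗ₜ 1) = 0 := by
  have h1 : degSign n B (b ⊗ₜ 1) = b ⊗ₜ 1 := by
    rw [degSign, TensorProduct.map_tmul, LinearMap.id_apply, Module.End.pow_apply,
      Function.iterate_fixed (by simp)]
  simp only [nablaDagger, LinearMap.neg_apply, LinearMap.smul_apply, LinearMap.comp_apply, h1]
  have h2 : nabla X (horHodge n B (b ⊗ₜ 1)) = 0 := by
    rw [horHodge, TensorProduct.map_tmul, hodge_one, nabla, LinearMap.sum_apply]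
    refine Finset.sum_eq_zero fun k _ => ?_
    rw [TensorProduct.map_tmul, LinearMap.mulLeft_apply, e_mul_extBasis (Finset.mem_univ k),
      TensorProduct.tmul_zero]
  rw [h2, map_zero, smul_zero, neg_zero]

/-- Among the eₗ only eₖ does not annihilate ⋆eₖ, so only Xₖ survives. The sign (−1)ⁿ from the
degree cancels the one in front. -/
lemma nablaDagger_e (b : B) (k : Fin n) : nablaDagger X (b ⊗ₜ e k) = -(X k b ⊗ₜ 1) := by
  have h0 : ∀ m : ℕ, ((CliffordAlgebra.involute : Ext n →ₐ[ℂ] Ext n).toLinearMap ^ m) (e k) =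
      (-1 : ℂ) ^ m • e k := by
    intro m
    induction m with
    | zero => simp
    | succ m ih =>
      rw [pow_succ', Module.End.mul_apply, ih, map_smul, AlgHom.toLinearMap_apply, e,
        ExteriorAlgebra.ι, CliffordAlgebra.involute_ι, pow_succ, mul_neg_one, neg_smul, smul_neg]
  have h1 : degSign n B (b ⊗ₜ e k) = (-1 : ℂ) ^ n • b ⊗ₜ e k := by
    rw [degSign, TensorProduct.map_tmul, LinearMap.id_apply, h0, TensorProduct.tmul_smul]
  have h2 : nabla X (horHodge n B (b ⊗ₜ e k)) = X k b ⊗ₜ extBasis n Finset.univ := by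
    rw [horHodge, TensorProduct.map_tmul, nabla, LinearMap.sum_apply]
    simp only [TensorProduct.map_tmul, LinearMap.mulLeft_apply, e_mul_hodge_e,
      LinearMap.id_apply, TensorProduct.tmul_ite]
    rw [Finset.sum_ite_eq' Finset.univ k (fun l => X l b ⊗ₜ[ℂ] extBasis n Finset.univ),
      if_pos (Finset.mem_univ k)]
  simp only [nablaDagger, LinearMap.neg_apply, LinearMap.smul_apply, LinearMap.comp_apply, h1,
    map_smul, h2]
  rw [smul_smul, ← mul_pow, neg_one_mul, neg_neg, one_pow, one_smul, horHodge,
    TensorProduct.map_tmul, hodge_univ]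
  rfl

/-- The operator `ψ ↦ ∑ᵢ Xᵢ² ψ` on spinor fields. -/
def sumSq : B ⊗[ℂ] Spinor n →ₗ[ℂ] B ⊗[ℂ] Spinor n :=
  ∑ i, TensorProduct.map (X i ∘ₗ X i) LinearMap.id

lemma sumSq_tmul (b : B) (s : Spinor n) : sumSq X (b ⊗ₜ s) = ∑ i, X i (X i b) ⊗ₜ s := by
  rw [sumSq, LinearMap.sum_apply]
  rfl

lemma laplacian_toForms (ψ : B ⊗[ℂ] Spinor n) :
    laplacian X (toForms n B ψ) = -toForms n B (sumSq X ψ) := by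
  have : laplacian X ∘ₗ toForms n B = -(toForms n B ∘ₗ sumSq X) := TensorProduct.ext' fun b s => by
    have h1 : nabla X (b ⊗ₜ 1) = ∑ k, X k b ⊗ₜ e k := by
      rw [nabla, LinearMap.sum_apply]
      simp
    have h2 : toForms n B (b ⊗ₜ s) = (b ⊗ₜ 1) ⊗ₜ s := rfl
    simp only [LinearMap.comp_apply, LinearMap.neg_apply, h2, laplacian, LinearMap.add_apply,
      LinearMap.rTensor_tmul, nablaDagger_zero, h1, map_sum, nablaDagger_e, map_zero,
      TensorProduct.zero_tmul, zero_add, Finset.sum_neg_distrib, TensorProduct.neg_tmul,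
      TensorProduct.sum_tmul, sumSq_tmul]
    rfl
  exact LinearMap.congr_fun this ψ

end

/-! ### The Clifford relations and the spin representation -/

lemma γ_mul_add_swap {n : ℕ} (i j : Fin n) :
    (γ i * γ j + γ j * γ i : Module.End ℂ (Spinor n)) = if i = j then 2 else 0 := by
  have h := cliffordAction_sq (n := n) (Pi.single i 1 + Pi.single j 1)
  have hi : γ i * γ i = (1 : Module.End ℂ (Spinor n)) := by
    refine (cliffordAction_sq (n := n) (Pi.single i 1)).trans ?_
    simp [Pi.single_apply]
  have hj : γ j * γ j = (1 : Module.End ℂ (Spinor n)) := by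
    refine (cliffordAction_sq (n := n) (Pi.single j 1)).trans ?_
    simp [Pi.single_apply]
  split_ifs with hij
  · subst hij
    rw [hi, one_add_one_eq_two]
  · have h1 : ∑ k, (Pi.single i 1 + Pi.single j 1 : Fin n → ℂ) k *
        (Pi.single i 1 + Pi.single j 1 : Fin n → ℂ) k = 1 + 1 := by
      simp [Pi.single_apply, mul_add, Finset.sum_add_distrib, hij, Ne.symm hij]
    rw [h1, map_add, map_add, map_one] at h
    change (γ i + γ j) * (γ i + γ j) = _ at h
    rw [add_mul, mul_add, mul_add, hi, hj] at h
    have h2 : γ i * γ j + γ j * γ i + (1 + 1) = 0 + (1 + 1 : Module.End ℂ (Spinor n)) := by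
      rw [zero_add]
      refine Eq.trans ?_ h
      abel
    exact add_right_cancel h2

lemma cliffordRep_ι {n : ℕ} (x : Fin n → ℝ) :
    cliffordRep n (CliffordAlgebra.ι _ x) = ∑ j, (x j : ℂ) • γ j := by
  have h1 : cliffordRep n (CliffordAlgebra.ι _ x) = cliffordAction n (fun i => (x i : ℂ)) := by
    rw [cliffordRep, CliffordAlgebra.lift_ι_apply]
    rfl
  rw [h1, ← (Pi.basisFun ℂ (Fin n)).sum_repr (fun i => (x i : ℂ)), map_sum]
  simp only [Pi.basisFun_repr, map_smul, Pi.basisFun_apply]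
  rfl

/-- This is g eᵢ = (g eᵢ g⁻¹) g in the Clifford algebra, applied to a spinor. -/
lemma cliffordRep_γ {n : ℕ} (g : Spin n) (i : Fin n) (s : Spinor n) :
    cliffordRep n g (γ i s) = ∑ j, (u n j i).1 g • γ j (cliffordRep n g s) := by
  obtain ⟨x, hx, hx'⟩ := conj_ι g i
  have h1 : (g : Cl n) * CliffordAlgebra.ι _ (Pi.single i 1) = CliffordAlgebra.ι _ x * (g : Cl n) := by
    rw [← hx, mul_assoc, ← Submonoid.coe_mul, inv_mul_cancel, Submonoid.coe_one, mul_one]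
  have h2 := LinearMap.congr_fun (congrArg (cliffordRep n) h1) s
  have h3 : ∑ j, ((Pi.single i 1 : Fin n → ℝ) j : ℂ) • γ j = (γ i : Module.End ℂ (Spinor n)) := by
    rw [Finset.sum_eq_single i]
    · simp
    · intro j _ hj
      simp [hj]
    · simp
  rw [map_mul, map_mul, cliffordRep_ι, cliffordRep_ι, h3, Module.End.mul_apply,
    Module.End.mul_apply, LinearMap.sum_apply] at h2
  rw [h2]
  refine Finset.sum_congr rfl fun j _ => ?_
  rw [LinearMap.smul_apply, ← hx']
  rfl

lemma U_apply {n : ℕ} (J I : Finset (Fin (n / 2))) (g : Spin n) :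
    (U n J I).1 g = (σ n).repr (cliffordRep n g (σ n I)) J := rfl

lemma evalTensor_spinCoaction {n : ℕ} (g : Spin n) (s : Spinor n) :
    evalTensor g (spinCoaction n s) = cliffordRep n g s := by
  have : evalTensor g ∘ₗ spinCoaction n = cliffordRep n g := (σ n).ext fun I => by
    rw [LinearMap.comp_apply, spinCoaction, Module.Basis.constr_basis, map_sum]
    simp only [evalTensor_tmul, U_apply]
    exact (σ n).sum_repr _
  exact LinearMap.congr_fun this s

lemma evalTensor_prodCoaction {n : ℕ} {A : Type*} [AddCommGroup A] [Module ℂ A]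
    (F : A →ₗ[ℂ] A ⊗[ℂ] Sn n) (g : Spin n) (ψ : A ⊗[ℂ] Spinor n) :
    evalTensor g (prodCoaction F ψ) =
      TensorProduct.map (evalTensor g ∘ₗ F) (cliffordRep n g) ψ := by
  have h1 : ∀ (t : A ⊗[ℂ] Sn n) (r : Spinor n ⊗[ℂ] Sn n),
      evalTensor g (TensorProduct.map LinearMap.id (LinearMap.mul' ℂ (Sn n))
        (TensorProduct.tensorTensorTensorComm ℂ A (Sn n) (Spinor n) (Sn n) (t ⊗ₜ r))) =
      evalTensor g t ⊗ₜ evalTensor g r := by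
    intro t r
    induction t using TensorProduct.induction_on with
    | zero => simp
    | add x y hx hy => simp only [TensorProduct.add_tmul, map_add, hx, hy]
    | tmul a c =>
      induction r using TensorProduct.induction_on with
      | zero => simp
      | add x y hx hy => simp only [TensorProduct.tmul_add, map_add, hx, hy]
      | tmul s d =>
        rw [TensorProduct.tensorTensorTensorComm_tmul, TensorProduct.map_tmul,
          LinearMap.mul'_apply, LinearMap.id_apply, evalTensor_tmul, evalTensor_tmul,
          evalTensor_tmul, TensorProduct.smul_tmul_smul]
        rfl
  have : evalTensor g ∘ₗ prodCoaction F =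
      TensorProduct.map (evalTensor g ∘ₗ F) (cliffordRep n g) := TensorProduct.ext' fun a s => by
    rw [TensorProduct.map_tmul, ← evalTensor_spinCoaction]
    exact h1 (F a) (spinCoaction n s)
  exact LinearMap.congr_fun this ψ

end

section

/-! ### Spinor fields -/

variable {n : ℕ} {V B : Type*} [Ring V] [Algebra ℂ V] [StarRing V] [StarModule ℂ V]
  [Ring B] [Algebra ℂ B] [StarRing B] [StarModule ℂ B]

/-- Contracting two vector indices is invariant under orthogonal matrices. Both the Dirac operator
and Σ Xᵢ² are such contractions, hence equivariant. -/
lemma sum_u_smul_u_smul {W : Type*} [AddCommGroup W] [Module ℂ W] (g : Spin n)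
    (T : Fin n → Fin n → W) :
    ∑ i, ∑ j, ∑ k, (u n j i).1 g • (u n k i).1 g • T j k = ∑ j, T j j := by
  have h : ∀ j k, ∑ i, (u n j i).1 g * (u n k i).1 g = if j = k then 1 else 0 := by
    intro j k
    have := congrArg (evalAt g) (sum_u_mul_u j k)
    rw [map_sum] at this
    refine this.trans ?_
    split_ifs
    · exact map_one _
    · exact map_zero _
  rw [Finset.sum_comm]
  refine Finset.sum_congr rfl fun j _ => ?_
  rw [Finset.sum_comm]
  simp only [smul_smul, ← Finset.sum_smul, h, ite_smul, one_smul, zero_smul, Finset.sum_ite_eq,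
    Finset.mem_univ, if_true]

/-- The action of a point of the spin group on spinor fields. -/
def SpinBundle.spinorAct (P : SpinBundle n V B) (g : Spin n) :
    B ⊗[ℂ] Spinor n →ₗ[ℂ] B ⊗[ℂ] Spinor n :=
  TensorProduct.map (P.act g) (cliffordRep n g)

lemma SpinBundle.spinorAct_tmul (P : SpinBundle n V B) (g : Spin n) (b : B) (s : Spinor n) :
    P.spinorAct g (b ⊗ₜ s) = P.act g b ⊗ₜ cliffordRep n g s := rfl

lemma SpinBundle.mem_sections_iff (P : SpinBundle n V B) (ψ : B ⊗[ℂ] Spinor n) :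
    ψ ∈ sections P ↔ ∀ g, P.spinorAct g ψ = ψ := by
  have h : ψ ∈ sections P ↔ prodCoaction P.F.toAlgHom.toLinearMap ψ = ψ ⊗ₜ 1 := by
    rw [sections, LinearMap.mem_ker, LinearMap.sub_apply, sub_eq_zero]
    rfl
  have h1 : ∀ g, evalTensor g (ψ ⊗ₜ[ℂ] (1 : Sn n)) = ψ := fun g => by
    rw [evalTensor_tmul, one_apply, one_smul]
  have h2 : ∀ g, evalTensor g (prodCoaction P.F.toAlgHom.toLinearMap ψ) = P.spinorAct g ψ :=
    fun g => evalTensor_prodCoaction _ g ψ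
  rw [h]
  constructor
  · intro h g
    rw [← h2, h, h1]
  · intro h
    exact evalTensor_ext fun g => by rw [h1, h2, h]

section

variable {P : SpinBundle n V B} {τ : FrameStructure P} (S : IntegrableSystem τ)

namespace IntegrableSystem

lemma act_X (g : Spin n) (i : Fin n) (b : B) :
    P.act g (S.X i b) = ∑ j, (u n j i).1 g • S.X j (P.act g b) := by
  rw [P.act_apply, S.F_X, map_sum]
  refine Finset.sum_congr rfl fun j _ => ?_
  rw [evalTensor_map (S.X j) _ g g ((u n j i).1 g) (fun a => rfl), P.act_apply]

lemma spinorAct_dirac (g : Spin n) (ψ : B ⊗[ℂ] Spinor n) :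
    P.spinorAct g (dirac S.X ψ) = dirac S.X (P.spinorAct g ψ) := by
  have : P.spinorAct g ∘ₗ dirac S.X = dirac S.X ∘ₗ P.spinorAct g :=
    TensorProduct.ext' fun b s => by
      simp only [LinearMap.comp_apply, dirac, LinearMap.neg_apply, LinearMap.smul_apply,
        LinearMap.sum_apply, TensorProduct.map_tmul, map_neg, map_smul, map_sum,
        P.spinorAct_tmul, S.act_X, cliffordRep_γ]
      simp only [TensorProduct.sum_tmul, TensorProduct.tmul_sum, TensorProduct.tmul_smul,
        ← TensorProduct.smul_tmul']
      congr 2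
      rw [← sum_u_smul_u_smul g fun j k => S.X j (P.act g b) ⊗ₜ[ℂ] γ k (cliffordRep n g s)]
      refine Finset.sum_congr rfl fun i _ => ?_
      simp only [Finset.smul_sum]
      rw [Finset.sum_comm]
      exact Finset.sum_congr rfl fun j _ => Finset.sum_congr rfl fun k _ => smul_comm _ _ _
  exact LinearMap.congr_fun this ψ

lemma spinorAct_sumSq (g : Spin n) (ψ : B ⊗[ℂ] Spinor n) :
    P.spinorAct g (sumSq S.X ψ) = sumSq S.X (P.spinorAct g ψ) := by
  have : P.spinorAct g ∘ₗ sumSq S.X = sumSq S.X ∘ₗ P.spinorAct g :=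
    TensorProduct.ext' fun b s => by
      simp only [LinearMap.comp_apply, sumSq_tmul, map_sum, P.spinorAct_tmul]
      simp only [← TensorProduct.sum_tmul]
      congr 1
      rw [← sum_u_smul_u_smul g fun j k => S.X j (S.X k (P.act g b))]
      simp only [S.act_X, map_sum, map_smul, Finset.smul_sum]
  exact LinearMap.congr_fun this ψ

end IntegrableSystem

/-! ### The square of the Dirac operator -/

/-- The symmetric half of γᵢγⱼ is δᵢⱼ; the rest sees only the antisymmetric part of `c`. -/
lemma sum_tmul_γ_γ (c : Fin n → Fin n → B) (s : Spinor n) :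
    ∑ i, ∑ j, c i j ⊗ₜ[ℂ] γ i (γ j s) = ∑ i, c i i ⊗ₜ[ℂ] s +
      (1 / 2 : ℂ) • ∑ i, ∑ j, (c i j - c j i) ⊗ₜ[ℂ] γ i (γ j s) := by
  have h1 : ∑ i, ∑ j, c j i ⊗ₜ[ℂ] γ i (γ j s) = ∑ i, ∑ j, c i j ⊗ₜ[ℂ] γ j (γ i s) :=
    Finset.sum_comm
  have h2 : ∑ i, ∑ j, c i j ⊗ₜ[ℂ] γ i (γ j s) + ∑ i, ∑ j, c i j ⊗ₜ[ℂ] γ j (γ i s) =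
      (2 : ℂ) • ∑ i, c i i ⊗ₜ[ℂ] s := by
    simp only [← Finset.sum_add_distrib, ← TensorProduct.tmul_add]
    rw [Finset.smul_sum]
    refine Finset.sum_congr rfl fun i _ => ?_
    have h3 : ∀ j, γ i (γ j s) + γ j (γ i s) = if i = j then (2 : ℂ) • s else 0 := by
      intro j
      have := LinearMap.congr_fun (γ_mul_add_swap i j) s
      refine this.trans ?_
      split_ifs
      · rw [two_smul]
        exact two_nsmul s
      · rfl
    simp only [h3, TensorProduct.tmul_ite, Finset.sum_ite_eq, Finset.mem_univ, if_true,
      TensorProduct.tmul_smul]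
  simp only [TensorProduct.sub_tmul, Finset.sum_sub_distrib]
  rw [h1, eq_sub_iff_add_eq'.mpr h2]
  module

lemma dirac_dirac_tmul (X : Fin n → B →ₗ[ℂ] B) (b : B) (s : Spinor n) :
    dirac X (dirac X (b ⊗ₜ s)) = -sumSq X (b ⊗ₜ s) -
      (1 / 2 : ℂ) • ∑ i, ∑ j, horComp B i j (nablaSq X b) ⊗ₜ[ℂ] γ i (γ j s) := by
  have h : dirac X (dirac X (b ⊗ₜ s)) = -∑ i, ∑ j, X i (X j b) ⊗ₜ[ℂ] γ i (γ j s) := by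
    simp only [dirac, LinearMap.neg_apply, LinearMap.smul_apply, LinearMap.sum_apply,
      TensorProduct.map_tmul, map_neg, map_smul, map_sum]
    rw [Finset.sum_neg_distrib, smul_neg, neg_neg, ← Finset.smul_sum, smul_smul,
      Complex.I_mul_I, neg_one_smul, Finset.sum_comm]
  rw [h, sum_tmul_γ_γ, sumSq_tmul, neg_add, sub_eq_add_neg]
  simp only [horComp_nablaSq]

/-! ### Components of invariant spinor fields under a classical curvature. -/

lemma sum_coeff (ψ : B ⊗[ℂ] Spinor n) : ∑ I, coeff I ψ ⊗ₜ[ℂ] σ n I = ψ := by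
  induction ψ using TensorProduct.induction_on with
  | zero => simp
  | add x y hx hy =>
    simp only [map_add, TensorProduct.add_tmul, Finset.sum_add_distrib, hx, hy]
  | tmul b s =>
    have h : ∀ I, coeff I (b ⊗ₜ[ℂ] s) = (σ n).repr s I • b := fun _ => rfl
    simp only [h, TensorProduct.smul_tmul, ← TensorProduct.tmul_sum]
    rw [(σ n).sum_repr]

/-- At a point g this is component J of the invariance of ψ. Keeping it as an identity in `B ⊗ 𝒮ₙ`
allows ϱ to be applied to it. -/
lemma sum_F_coeff_mul_U {ψ : B ⊗[ℂ] Spinor n} (hψ : ψ ∈ sections P)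
    (J : Finset (Fin (n / 2))) :
    ∑ I, P.F (coeff I ψ) * (1 ⊗ₜ U n J I) = coeff J ψ ⊗ₜ 1 := by
  refine evalTensor_ext fun g => ?_
  have h1 : ∀ (b : B) s, coeff J (b ⊗ₜ[ℂ] s) = (σ n).repr s J • b := fun _ _ => rfl
  have h2 := (P.mem_sections_iff ψ).mp hψ g
  have h3 : coeff J (P.spinorAct g ψ) = ∑ I, (U n J I).1 g • P.act g (coeff I ψ) := by
    conv_lhs => rw [← sum_coeff ψ]
    simp only [map_sum, P.spinorAct_tmul, h1, U_apply]
  rw [h2] at h3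
  rw [evalTensor_tmul, one_apply, one_smul, h3, map_sum]
  refine Finset.sum_congr rfl fun I _ => ?_
  rw [evalTensor_mul, evalTensor_tmul, mul_smul_comm, mul_one, P.act_apply]

/-- The derivation rule is applied in the second tensor factor; `evalTensor 1` is id ⊗ ε. -/
lemma IsClassical.convolve_mul {ϱ : Sn n →ₗ[ℂ] Hor n B} (h : IsClassical ϱ)
    (t : B ⊗[ℂ] Sn n) (v : Sn n) :
    convolve ϱ (t * (1 ⊗ₜ v)) = (evalTensor 1 t ⊗ₜ 1) * ϱ v + counit n v • convolve ϱ t := by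
  have : convolve ϱ ∘ₗ LinearMap.mulRight ℂ (1 ⊗ₜ v) =
      LinearMap.mulRight ℂ (ϱ v) ∘ₗ (Algebra.TensorProduct.includeLeft : B →ₐ[ℂ] Hor n B).toLinearMap ∘ₗ
        evalTensor 1 + counit n v • convolve ϱ := TensorProduct.ext' fun b a => by
    simp only [LinearMap.comp_apply, LinearMap.mulRight_apply, LinearMap.add_apply,
      LinearMap.smul_apply, Algebra.TensorProduct.tmul_mul_tmul, mul_one, convolve_tmul,
      evalTensor_tmul, AlgHom.toLinearMap_apply, map_smul, h a v, mul_add, mul_smul_comm]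
    rfl
  exact LinearMap.congr_fun this t

/-- Convolve `sum_F_coeff_mul_U` with ϱ. The right side vanishes because a derivation kills 1. On
the left ε(U_{JI}) = δ_{JI} isolates the term of ψ_J. -/
lemma IsClassical.convolve_F_coeff {ϱ : Sn n →ₗ[ℂ] Hor n B} (h : IsClassical ϱ)
    {ψ : B ⊗[ℂ] Spinor n} (hψ : ψ ∈ sections P) (J : Finset (Fin (n / 2))) :
    convolve ϱ (P.F (coeff J ψ)) = -∑ I, (coeff I ψ ⊗ₜ 1) * ϱ (U n J I) := by
  have h1 : ϱ 1 = 0 := by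
    have := h 1 1
    rwa [mul_one, map_one (counit n), one_smul, left_eq_add] at this
  have h2 : ∀ I, counit n (U n J I) = if I = J then 1 else 0 := by
    intro I
    have : counit n (U n J I) = (σ n).repr (cliffordRep n 1 (σ n I)) J := rfl
    rw [this, map_one, Module.End.one_apply, Module.Basis.repr_self, Finsupp.single_apply]
  have h3 := congrArg (convolve ϱ) (sum_F_coeff_mul_U hψ J)
  rw [map_sum, convolve_tmul, h1, mul_zero] at h3
  simp only [h.convolve_mul, h2, ← P.act_apply, P.act_one, Finset.sum_add_distrib, ite_smul,
    one_smul, zero_smul, Finset.sum_ite_eq', Finset.mem_univ, if_true] at h3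
  exact eq_neg_of_add_eq_zero_right h3

lemma horComp_mul (i j : Fin n) (b : B) (w : Hor n B) :
    horComp B i j ((b ⊗ₜ 1) * w) = b * horComp B i j w := by
  have : horComp B i j ∘ₗ LinearMap.mulLeft ℂ (b ⊗ₜ 1) =
      LinearMap.mulLeft ℂ b ∘ₗ horComp B i j := TensorProduct.ext' fun c v => by
    simp only [LinearMap.comp_apply, LinearMap.mulLeft_apply, Algebra.TensorProduct.tmul_mul_tmul,
      one_mul, horComp_tmul, mul_smul_comm]
  exact LinearMap.congr_fun this w

/-- The Lichnerowicz formula. -/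
theorem dirac_dirac {X : Fin n → B →ₗ[ℂ] B} {ϱ : Sn n →ₗ[ℂ] Hor n B} (hϱ : IsCurvature P X ϱ)
    (h : IsClassical ϱ) {ψ : B ⊗[ℂ] Spinor n} (hψ : ψ ∈ sections P) :
    dirac X (dirac X ψ) = -sumSq X ψ + curvOp ϱ ψ := by
  have h1 : curvOp ϱ ψ = -((1 / 2 : ℂ) • ∑ i, ∑ j, ∑ I, ∑ J,
      (coeff I ψ * horComp B i j (ϱ (U n J I))) ⊗ₜ γ i (γ j (σ n J))) := by
    simp only [curvOp, LinearMap.neg_apply, LinearMap.smul_apply, LinearMap.sum_apply]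
    rfl
  have h2 : ∀ J i j, horComp B i j (nablaSq X (coeff J ψ)) =
      ∑ I, coeff I ψ * horComp B i j (ϱ (U n J I)) := by
    intro J i j
    have := hϱ.convolve_F (coeff J ψ)
    -- Both expressions for the convolution carry a minus sign, leaving ∇²ψ_J = Σ_I ψ_I ϱ(U_{JI}).
    rw [h.convolve_F_coeff hψ, neg_inj] at this
    rw [← this, map_sum]
    simp only [horComp_mul]
  have h3 : dirac X (dirac X ψ) = ∑ J, dirac X (dirac X (coeff J ψ ⊗ₜ σ n J)) := by
    conv_lhs => rw [← sum_coeff ψ]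
    simp only [map_sum]
  have h4 : sumSq X ψ = ∑ J, sumSq X (coeff J ψ ⊗ₜ σ n J) := by
    conv_lhs => rw [← sum_coeff ψ]
    simp only [map_sum]
  rw [h3, h4, h1]
  simp only [dirac_dirac_tmul, h2, Finset.sum_sub_distrib, Finset.sum_neg_distrib,
    TensorProduct.sum_tmul]
  rw [sub_eq_add_neg, ← Finset.smul_sum]
  congr 3
  rw [Finset.sum_comm]
  refine Finset.sum_congr rfl fun i _ => ?_
  rw [Finset.sum_comm]
  exact Finset.sum_congr rfl fun j _ => Finset.sum_comm

end

end

end QSpin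

end

theorem mainTheorem1 (n : ℕ) {V B : Type*}
    [Ring V] [Algebra ℂ V] [StarRing V] [StarModule ℂ V]
    [Ring B] [Algebra ℂ B] [StarRing B] [StarModule ℂ B]
    (P : QSpin.SpinBundle n V B) (τ : QSpin.FrameStructure P) (S : QSpin.IntegrableSystem τ) :
    (∃! ϱ : QSpin.Sn n →ₗ[ℂ] QSpin.Hor n B, QSpin.IsCurvature P S.X ϱ) ∧
    ∀ ϱ : QSpin.Sn n →ₗ[ℂ] QSpin.Hor n B, QSpin.IsCurvature P S.X ϱ →
      (∀ a, ϱ a = (1 / 2 : ℂ) •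
        ∑ i, ∑ j, QSpin.curvComp ϱ i j a ⊗ₜ[ℂ] (QSpin.e i * QSpin.e j)) ∧
      (QSpin.IsClassical ϱ → ∀ ψ ∈ QSpin.sections P,
        QSpin.dirac S.X ψ ∈ QSpin.sections P ∧
        QSpin.curvOp ϱ ψ ∈ QSpin.sections P ∧
        QSpin.toForms n B (QSpin.dirac S.X (QSpin.dirac S.X ψ)) =
          QSpin.laplacian S.X (QSpin.toForms n B ψ) +
            QSpin.toForms n B (QSpin.curvOp ϱ ψ)) := by
  refine ⟨S.existsUnique_curvature, fun ϱ hϱ => ⟨fun a => QSpin.twoForm_eq_sum (hϱ.mem_twoForms a),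
    fun h ψ hψ => ?_⟩⟩
  have hD : ∀ φ ∈ QSpin.sections P, QSpin.dirac S.X φ ∈ QSpin.sections P := by
    intro φ hφ
    rw [P.mem_sections_iff] at hφ ⊢
    exact fun g => by rw [S.spinorAct_dirac, hφ]
  have hQ : QSpin.sumSq S.X ψ ∈ QSpin.sections P := by
    rw [P.mem_sections_iff] at hψ ⊢
    exact fun g => by rw [S.spinorAct_sumSq, hψ]
  have hL := QSpin.dirac_dirac hϱ h hψ
  refine ⟨hD ψ hψ, ?_, ?_⟩
  · have h2 : QSpin.curvOp ϱ ψ = QSpin.dirac S.X (QSpin.dirac S.X ψ) + QSpin.sumSq S.X ψ := by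
      rw [hL]
      abel
    rw [h2]
    exact add_mem (hD _ (hD ψ hψ)) hQ
  · rw [QSpin.laplacian_toForms, hL, map_add, map_neg]
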